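/- Let $k$ be an algebraically closed field, let $X$ be a closed subscheme of $\mathbb{A}^N$ over $k$ whose ideal $I_X=(f_1,\ldots,f_m)\subset k[x_1,\ldots,x_N]$ is generated by $m\le N$ polynomials, and let $0\le e_1\le e_2\le\cdots\le e_m$ be integers (with the convention $e_0=0$ if $m=0$). Notation. An arc on $X$ is a tuple $\gamma\in k[[t]]^N$ at which all elements of $I_X$ vanish; an $n$-jet on $X$ is a tuple $\theta\in (k[t]/(t^{n+1}))^N$ at which all elements of $I_X$ vanish. The $n$-jets on $\mathbb{A}^N$ are identified by their coefficients with the closed points of the affine space $\mathbb{A}^{N(n+1)}$, and sets of jets carry the Zariski topology and, when locally closed, the reduced variety structure. Write $\pi_n$ for the truncation of arcs to $n$-jets and $\pi^n_l$ for the truncation of $n$-jets to $l$-jets ($l\le n$). Let $\mathcal{L}^{e_1,\ldots,e_m}(X)$ be the set of arcs $\gamma$ on $X$ for which the quotient of $k[[t]]^N$ by the submodule generated by the rows of $\left(\frac{\partial f_i}{\partial x_j}(\gamma)\right)_{i,j}$ is isomorphic to $\bigoplus_{i=1}^m k[[t]]/(t^{e_i})\oplus k[[t]]^{N-m}$. For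 an $n$-jet $\theta$ let $0\le e_1(\theta)\le\cdots\le e_N(\theta)\le n+1$ be the integers for which the quotient of $(k[t]/(t^{n+1}))^N$ by the $k[[t]]$-submodule generated by the rows of $\left(\frac{\partial f_i}{\partial x_j}(\theta)\right)_{i,j}$ is isomorphic to $\bigoplus_{j=1}^N k[[t]]/(t^{e_j(\theta)})$, and let $\mathcal{L}_n^{e_1,\ldots,e_m}(X)$ be the set of $n$-jets $\theta$ on $X$ with $e_i(\theta)=e_i$ for $1\le i\le m$ and, if $m<N$, $e_{m+1}(\theta)\ge\lceil n/2\rceil$. A morphism $T\to S$ is a trivial fibration with fibre $\mathbb{A}^d$ if there is an isomorphism $T\cong S\times\mathbb{A}^d$ over $S$; it is a locally trivial fibration with fibre $\mathbb{A}^d$ if every point of $S$ has an open neighbourhood over which it is a trivial fibration with fibre $\mathbb{A}^d$. Proposition 1. (a) For $l\ge e_m$ and $i\ge e_m$ we have $$\pi^{l+i}_l\bigl(\mathcal{L}^{e_1,\ldots,e_m}_{l+i}(X)\bigr)=\pi_l\bigl(\mathcal{L}^{e_1,\ldots,e_m}(X)\bigr),$$ and this set is locally closed. (b) For every $\gamma\in\pi_{e_m}(\mathcal{L}^{e_1,\ldots,e_m}(X))$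 there is an open subset $U_{e_m}$ of $\pi_{e_m}(\mathcal{L}^{e_1,\ldots,e_m}(X))$ containing $\gamma$ such that, if $U_i$ denotes for $i>e_m$ the inverse image of $U_{e_m}$ under the truncation map $\pi_i(\mathcal{L}^{e_1,\ldots,e_m}(X))\to\pi_{e_m}(\mathcal{L}^{e_1,\ldots,e_m}(X))$, then for all $l\ge e_m$ the truncation map $U_{l+1}\to U_l$ is a trivial fibration with fibre $\mathbb{A}^{N-m}$. (c) For $n>l\ge e_m$ the truncation map $$\pi_n\bigl(\mathcal{L}^{e_1,\ldots,e_m}(X)\bigr)\to\pi_l\bigl(\mathcal{L}^{e_1,\ldots,e_m}(X)\bigr)$$ is a locally trivial fibration with fibre $\mathbb{A}^{(N-m)(n-l)}$. -/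

import Mathlib

noncomputable section

namespace JetArc

open MvPolynomial

universe u

variable {k : Type u} [Field k]

/-! ## Classical varieties in affine space over an algebraically closed field

Closed points of the affine space with coordinates indexed by `σ` are functions `σ → k`. -/

/-- The common zero set in `k^σ` of a set of polynomials. -/
def zeroSet {σ : Type} (P : Set (MvPolynomial σ k)) : Set (σ → k) :=
  {x | ∀ p ∈ P, eval x p = 0}

/-- The Zariski topology on `k^σ`: the closed sets are the zero sets of sets of polynomials. -/
@[reducible]
def zariski (k : Type u) [Field k] (σ : Type) : TopologicalSpace (σ → k) :=
  TopologicalSpace.ofClosed {Z | ∃ P : Set (MvPolynomial σ k), Z = zeroSet P}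
    ⟨{1}, by ext x; simp [zeroSet]⟩
    (by
      intro A hA
      refine ⟨{p | ∀ x ∈ ⋂₀ A, eval x p = 0}, ?_⟩
      ext x
      constructor
      · intro hx p hp
        exact hp x hx
      · intro hx Z hZ
        obtain ⟨P, rfl⟩ := hA hZ
        intro p hp
        exact hx p fun y hy => hy _ hZ p hp)
    (by
      rintro _ ⟨P, rfl⟩ _ ⟨Q, rfl⟩
      refine ⟨{r | ∃ p ∈ P, ∃ q ∈ Q, r = p * q}, ?_⟩
      ext x
      constructor
      · rintro (hx | hx) _ ⟨p, hp, q, hq, rfl⟩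
        · simp [hx p hp]
        · simp [hx q hq]
      · intro hx
        by_contra hcon
        rw [Set.mem_union, not_or] at hcon
        obtain ⟨h1, h2⟩ := hcon
        have h1' : ∃ p ∈ P, eval x p ≠ 0 := by
          by_contra hne
          push Not at hne
          exact h1 hne
        have h2' : ∃ q ∈ Q, eval x q ≠ 0 := by
          by_contra hne
          push Not at hne
          exact h2 hne
        obtain ⟨p, hp, hp0⟩ := h1'
        obtain ⟨q, hq, hq0⟩ := h2'
        have := hx (p * q) ⟨p, hp, q, hq, rfl⟩
        rw [map_mul] at this
        exact (mul_ne_zero hp0 hq0) this)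

/-- `S` is locally closed for the Zariski topology. -/
def IsLocClosed {σ : Type} (S : Set (σ → k)) : Prop :=
  @IsLocallyClosed (σ → k) (zariski k σ) S

/-- `U` is a (relatively) Zariski open subset of `S`. -/
def IsOpenSubsetOf {σ : Type} (U S : Set (σ → k)) : Prop :=
  ∃ O : Set (σ → k), @IsOpen (σ → k) (zariski k σ) O ∧ U = S ∩ O

/-- `h` is a regular function on the (locally closed) subset `S` of `k^σ`: Zariski locally on
`S` it is a quotient of two polynomials. -/
def IsRegularFun {σ : Type} (S : Set (σ → k)) (h : (σ → k) → k) : Prop :=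
  ∀ x ∈ S, ∃ p q : MvPolynomial σ k, eval x q ≠ 0 ∧
    ∀ y ∈ S, eval y q ≠ 0 → h y = eval y p / eval y q

/-- `φ` restricts to a morphism of varieties from `S ⊆ k^σ` to `T ⊆ k^τ`, both with their
reduced structure. -/
def IsMorphism {σ τ : Type} (S : Set (σ → k)) (T : Set (τ → k)) (φ : (σ → k) → (τ → k)) : Prop :=
  Set.MapsTo φ S T ∧ ∀ j : τ, IsRegularFun S fun x => φ x j

/-- The product `S × 𝔸^d`, inside the affine space `k^(σ ⊕ Fin d) = k^σ × k^d`. -/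
def prodAffine {σ : Type} (S : Set (σ → k)) (d : ℕ) : Set (σ ⊕ Fin d → k) :=
  {z | (fun s => z (Sum.inl s)) ∈ S}

/-- The map `π`, restricted to `T → S`, is a trivial fibration with fibre `𝔸^d`: it is a
morphism, and there is an isomorphism of varieties `T ≅ S × 𝔸^d` which turns it into the first
projection. -/
def IsTrivialFibration {σ τ : Type} (T : Set (σ → k)) (S : Set (τ → k))
    (π : (σ → k) → (τ → k)) (d : ℕ) : Prop :=
  IsMorphism T S π ∧
  ∃ (Φ : (σ → k) → (τ ⊕ Fin d → k)) (Ψ : (τ ⊕ Fin d → k) → (σ → k)),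
    IsMorphism T (prodAffine S d) Φ ∧ IsMorphism (prodAffine S d) T Ψ ∧
    (∀ x ∈ T, Ψ (Φ x) = x) ∧ (∀ z ∈ prodAffine S d, Φ (Ψ z) = z) ∧
    ∀ x ∈ T, (fun s => Φ x (Sum.inl s)) = π x

/-- The map `π`, restricted to `T → S`, is a locally trivial fibration with fibre `𝔸^d`: every
point of `S` has a Zariski open neighbourhood in `S` over which it is a trivial fibration. -/
def IsLocallyTrivialFibration {σ τ : Type} (T : Set (σ → k)) (S : Set (τ → k))
    (π : (σ → k) → (τ → k)) (d : ℕ) : Prop :=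
  IsMorphism T S π ∧
  ∀ s ∈ S, ∃ U : Set (τ → k), IsOpenSubsetOf U S ∧ s ∈ U ∧
    IsTrivialFibration {x ∈ T | π x ∈ U} U π d

/-! ## Arcs and jets -/

/-- The ring `k[[t]]/(t^(n+1))`. -/
abbrev TruncRing (k : Type u) [Field k] (n : ℕ) : Type u :=
  PowerSeries k ⧸ Ideal.span {(PowerSeries.X : PowerSeries k) ^ (n + 1)}

/-- The arcs on `𝔸^N`, given by their coordinates `(γ_1(t), …, γ_N(t))`. -/
abbrev Arc (k : Type u) [Field k] (N : ℕ) : Type u := Fin N → PowerSeries k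

/-- The `n`-jets on `𝔸^N`, i.e. the closed points of `𝓛_n(𝔸^N)`, given by the coordinates
`a_{j,i}`, where the `j`-th component of the jet is `a_{j,0} + a_{j,1} t + ⋯ + a_{j,n} t^n`. -/
abbrev Jet (k : Type u) [Field k] (N n : ℕ) : Type u := Fin N × Fin (n + 1) → k

/-- The components `θ_1(t), …, θ_N(t)` in `k[[t]]/(t^(n+1))` of an `n`-jet on `𝔸^N`. -/
def Jet.comp {N n : ℕ} (θ : Jet k N n) (j : Fin N) : TruncRing k n :=
  Ideal.Quotient.mk _
    (∑ i : Fin (n + 1), PowerSeries.C (θ (j, i)) * PowerSeries.X ^ (i : ℕ))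

/-- The truncation map `π_n` from arcs to `n`-jets. -/
def truncArc {N : ℕ} (n : ℕ) (γ : Arc k N) : Jet k N n :=
  fun s => PowerSeries.coeff (s.2 : ℕ) (γ s.1)

/-- The truncation map `π^n_l` from `n`-jets to `l`-jets, for `l ≤ n`. -/
def truncJet {N n l : ℕ} (h : l ≤ n) (θ : Jet k N n) : Jet k N l :=
  fun s => θ (s.1, Fin.castLE (Nat.succ_le_succ h) s.2)

/-- The arcs on the closed subscheme of `𝔸^N` with ideal `I`. -/
def arcs {N : ℕ} (I : Ideal (MvPolynomial (Fin N) k)) : Set (Arc k N) :=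
  {γ | ∀ p ∈ I, aeval γ p = 0}

/-- The `n`-jets on the closed subscheme of `𝔸^N` with ideal `I`. -/
def jets {N : ℕ} (I : Ideal (MvPolynomial (Fin N) k)) (n : ℕ) : Set (Jet k N n) :=
  {θ | ∀ p ∈ I, aeval θ.comp p = 0}

/-! ## Invariant factors of the Jacobian matrix -/

/-- The Jacobian matrix of `f_1, …, f_m`, evaluated at a point of `𝔸^N` with coordinates in the
`k`-algebra `R`. -/
def jacobian {N m : ℕ} {R : Type u} [CommRing R] [Algebra k R]
    (f : Fin m → MvPolynomial (Fin N) k) (a : Fin N → R) : Matrix (Fin m) (Fin N) R :=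
  fun i j => aeval a (pderiv j (f i))

/-- The module `M(f_1, …, f_m; γ)`: the quotient of `k[[t]]^N` by the submodule generated by the
rows of the Jacobian matrix at the arc `γ`. -/
abbrev arcModule {N m : ℕ} (f : Fin m → MvPolynomial (Fin N) k) (γ : Arc k N) : Type u :=
  (Fin N → PowerSeries k) ⧸
    Submodule.span (PowerSeries k) (Set.range fun i => jacobian f γ i)

/-- The `k[[t]]`-module `M_n(f_1, …, f_m; θ)`: the quotient of `(k[[t]]/(t^(n+1)))^N` by the
submodule generated by the rows of the Jacobian matrix at the `n`-jet `θ`. -/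
abbrev jetModule {N m n : ℕ} (f : Fin m → MvPolynomial (Fin N) k) (θ : Jet k N n) : Type u :=
  (Fin N → TruncRing k n) ⧸
    Submodule.span (PowerSeries k) (Set.range fun i => jacobian f θ.comp i)

/-- The `k[[t]]`-module `k[[t]]/(t^e)`. -/
abbrev CyclicModule (k : Type u) [Field k] (e : ℕ) : Type u :=
  PowerSeries k ⧸ Ideal.span {(PowerSeries.X : PowerSeries k) ^ e}

/-- The set `𝓜^{e_1,…,e_p}(f_1, …, f_m)` of the arcs on `𝔸^N` at which the invariant factors of the
Jacobian matrix are `t^{e_1}, …, t^{e_p}` (for `e_1 ≤ ⋯ ≤ e_p` and `p ≤ N`), i.e.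
`M ≅ k[[t]]/(t^{e_1}) ⊕ ⋯ ⊕ k[[t]]/(t^{e_p}) ⊕ k[[t]]^{N-p}`. -/
def ambientArcsOfType {N m p : ℕ} (f : Fin m → MvPolynomial (Fin N) k) (e : Fin p → ℕ) :
    Set (Arc k N) :=
  {γ | Nonempty (arcModule f γ ≃ₗ[PowerSeries k]
    ((i : Fin p) → CyclicModule k (e i)) × (Fin (N - p) → PowerSeries k))}

/-- The set `𝓛^{e_1,…,e_p}(X) = 𝓛(X) ∩ 𝓜^{e_1,…,e_p}(f_1, …, f_m)`, where `X` has ideal `I` and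
`f_1, …, f_m` generate `I`. -/
def arcsOfType {N m p : ℕ} (I : Ideal (MvPolynomial (Fin N) k))
    (f : Fin m → MvPolynomial (Fin N) k) (e : Fin p → ℕ) : Set (Arc k N) :=
  arcs I ∩ ambientArcsOfType f e

/-- `0 ≤ E_1 ≤ ⋯ ≤ E_N ≤ n + 1` is the sequence `e_1(f;θ), …, e_N(f;θ)` of the `n`-jet `θ`:
`M_n ≅ k[[t]]/(t^{E_1}) ⊕ ⋯ ⊕ k[[t]]/(t^{E_N})`. -/
def IsJetExponents {N m n : ℕ} (f : Fin m → MvPolynomial (Fin N) k) (θ : Jet k N n)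
    (E : Fin N → ℕ) : Prop :=
  Monotone E ∧ (∀ j, E j ≤ n + 1) ∧
    Nonempty (jetModule f θ ≃ₗ[PowerSeries k] ((j : Fin N) → CyclicModule k (E j)))

/-- The set `𝓜_n^{e_1,…,e_b}(f_1, …, f_m)` (for `b ≤ N`) of the `n`-jets `θ` on `𝔸^N` with
`e_i(f;θ) = e_i` for `1 ≤ i ≤ b` and, if `b < N`, with `e_{b+1}(f;θ) ≥ g`, where `g = ⌈n/2⌉`.
The indices of `E` start at `0`, so `e_{b+1}(f;θ)` is the value of `E` at the index `b`. -/
def ambientJetsOfType {N m b : ℕ} (n : ℕ) (f : Fin m → MvPolynomial (Fin N) k) (e : Fin b → ℕ) :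
    Set (Jet k N n) :=
  {θ | ∃ E : Fin N → ℕ, IsJetExponents f θ E ∧
    (∀ (i : Fin b) (j : Fin N), (j : ℕ) = i → E j = e i) ∧
    ∀ j : Fin N, (j : ℕ) = b → (n + 1) / 2 ≤ E j}

/-- The set `𝓛_n^{e_1,…,e_b}(X) = 𝓛_n(X) ∩ 𝓜_n^{e_1,…,e_b}(f_1, …, f_m)`, where `X` has ideal `I`
and `f_1, …, f_m` generate `I`. -/
def jetsOfType {N m b : ℕ} (n : ℕ) (I : Ideal (MvPolynomial (Fin N) k))
    (f : Fin m → MvPolynomial (Fin N) k) (e : Fin b → ℕ) : Set (Jet k N n) :=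
  jets I n ∩ ambientJetsOfType n f e

/-- The last term `e_m` of an increasing sequence `e_1 ≤ ⋯ ≤ e_m`, with `e_0 = 0` if `m = 0`. -/
def lastExp {m : ℕ} (e : Fin m → ℕ) : ℕ := Finset.univ.sup e

theorem lastExp_eq {m : ℕ} (e : Fin (m + 1) → ℕ) (he : Monotone e) :
    lastExp e = e (Fin.last m) :=
  le_antisymm (Finset.sup_le fun i _ => he (Fin.le_last i)) (Finset.le_sup (Finset.mem_univ _))

/-- The set `π_n(𝓛^{e_1,…,e_p}(X))` of `n`-jets, where `X` has ideal `I` and `f_1, …, f_m`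
generate `I`. -/
def truncatedArcs {N m p : ℕ} (n : ℕ) (I : Ideal (MvPolynomial (Fin N) k))
    (f : Fin m → MvPolynomial (Fin N) k) (e : Fin p → ℕ) : Set (Jet k N n) :=
  truncArc n '' arcsOfType I f e

end JetArc

end

/-!
# Truncations of arcs with prescribed invariant factors of the Jacobian matrix

Write `R = k[[t]]`, let `J` be the Jacobian matrix of `f` at an arc on affine space, and let
`s = e_1 + ⋯ + e_m`.

If `J` has type `e`, then it is `P * diag(t^{e_1}, …, t^{e_m}) * B` with `P` invertible and `B` right
invertible (`HasType.exists_factorization`). Hence its image contains `t^{e_m} R^m`, all its maximal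
minors are divisible by `t^s`, and some minor `det J_α` has order exactly `s`. Moreover the type is
determined by the dimensions of `M / t^q M` for `q ≤ e_m + 1`, where `M` is the cokernel of the rows
(`hasType_iff_codim`), so it only depends on `J` modulo `t^(e_m + 1)` (`HasType.congr`). Being of a
given type is a locally closed condition, as those dimensions are upper semicontinuous
(`isLocallyClosed_hasType`).

Let `γ₀` have type `e` and let `l ≥ e_m`. By Taylor expansion and Hensel's lemma
(`exists_arc_of_dvd`), `γ₀` agrees modulo `t^(l+1)` with an arc on `X` if and only if `f(γ₀)` lies in
`t^(l+1) J(γ₀) R^N` (`exists_arc_iff`). This holds if `f(γ₀) ≡ 0` modulo `t^(l+e_m+1)`, which gives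
the equality of images in (a); by Cramer's rule it is a closed condition on the jets of type `e`,
namely that the entries of `adj(J_α) f(γ₀)` are divisible by `t^(l+1+s)` for all `α`.

On the chart where `det J_α` has order `s`, the same criterion describes the fibres of the
truncation from level `l + 1` to level `l`: the jet `η + t^(l+1) v` lifts to an arc of type `e` if
and only if the coefficients of `t^(l+1+s)` in `adj(J_α) (f(η) + t^(l+1) J v)` vanish
(`snocJet_mem_iff`). These equations are affine linear in `v`, and `v_α` enters through the leading
coefficient of `det J_α` times `v_α`. So they express `v_α` as a regular function of `η` and the
other `N - m` coordinates of `v`, which is a trivialization (`isTrivialFibration_chart`). The leading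
coefficient only depends on the `e_m`-jet (`HasType.coeff_det_eq`), so one chart serves all levels,
and composing the trivializations of successive levels gives (c).
-/

noncomputable section
namespace JetArc
open MvPolynomial
universe u
variable {k : Type u} [Field k]

/-! ### Regular functions, morphisms and fibrations -/

theorem isClosed_zeroSet {σ : Type} (P : Set (MvPolynomial σ k)) :
    @IsClosed (σ → k) (zariski k σ) (zeroSet P) := by
  rw [← @isOpen_compl_iff _ _ (zariski k σ)]
  exact ⟨P, by simp⟩

theorem isOpen_eval_ne_zero {σ : Type} (p : MvPolynomial σ k) :
    @IsOpen (σ → k) (zariski k σ) {x | eval x p ≠ 0} :=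
  ⟨{p}, by ext x; simp [zeroSet]⟩

/-- `h` is a quotient of two polynomials on a Zariski neighbourhood of `x` in `S`. -/
def IsRegularAt {σ : Type} (S : Set (σ → k)) (x : σ → k) (h : (σ → k) → k) : Prop :=
  ∃ p q : MvPolynomial σ k, eval x q ≠ 0 ∧ ∀ y ∈ S, eval y q ≠ 0 → h y = eval y p / eval y q

theorem IsRegularAt.add {σ : Type} {S : Set (σ → k)} {x : σ → k} {g h : (σ → k) → k}
    (hg : IsRegularAt S x g) (hh : IsRegularAt S x h) :
    IsRegularAt S x (fun y => g y + h y) := by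
  obtain ⟨p, q, hq, hpq⟩ := hg
  obtain ⟨p', q', hq', hpq'⟩ := hh
  refine ⟨p * q' + q * p', q * q', by simp [hq, hq'], fun y hy hne => ?_⟩
  rw [map_mul] at hne
  have h1 := left_ne_zero_of_mul hne
  have h2 := right_ne_zero_of_mul hne
  simp only [hpq y hy h1, hpq' y hy h2, map_add, map_mul]
  rw [div_add_div _ _ h1 h2]

theorem IsRegularAt.mul {σ : Type} {S : Set (σ → k)} {x : σ → k} {g h : (σ → k) → k}
    (hg : IsRegularAt S x g) (hh : IsRegularAt S x h) :
    IsRegularAt S x (fun y => g y * h y) := by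
  obtain ⟨p, q, hq, hpq⟩ := hg
  obtain ⟨p', q', hq', hpq'⟩ := hh
  refine ⟨p * p', q * q', by simp [hq, hq'], fun y hy hne => ?_⟩
  rw [map_mul] at hne
  simp only [hpq y hy (left_ne_zero_of_mul hne), hpq' y hy (right_ne_zero_of_mul hne), map_mul]
  rw [div_mul_div_comm]

/-- Where `g x ≠ 0`, the quotient `h / g` is regular at `x`. Only the values of the result at
points of `S` with `g ≠ 0` matter. -/
theorem IsRegularAt.of_div {σ : Type} {S : Set (σ → k)} {x : σ → k} {g h w : (σ → k) → k}
    (hx : x ∈ S) (hh : IsRegularAt S x h) (hg : IsRegularAt S x g) (hgx : g x ≠ 0)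
    (hw : ∀ y ∈ S, g y ≠ 0 → w y = h y / g y) : IsRegularAt S x w := by
  obtain ⟨p, q, hq, hpq⟩ := hh
  obtain ⟨p', q', hq', hpq'⟩ := hg
  have hp' : eval x p' ≠ 0 := fun h0 => hgx (by rw [hpq' x hx hq', h0, zero_div])
  refine ⟨p * q' * q', q * p' * q', by simp [hq, hq', hp'], fun y hy hne => ?_⟩
  simp only [map_mul, mul_ne_zero_iff] at hne
  obtain ⟨⟨h1, h2⟩, h3⟩ := hne
  have hg0 : g y ≠ 0 := by
    rw [hpq' y hy h3]
    exact div_ne_zero h2 h3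
  rw [hw y hy hg0, hpq y hy h1, hpq' y hy h3]
  simp only [map_mul]
  field_simp

theorem isRegularAt_eval_comp {σ τ : Type} {S : Set (σ → k)} {x : σ → k}
    {φ : (σ → k) → (τ → k)} (hφ : ∀ j, IsRegularAt S x fun y => φ y j)
    (p : MvPolynomial τ k) : IsRegularAt S x fun y => eval (φ y) p := by
  induction p using MvPolynomial.induction_on with
  | C a =>
    exact ⟨C a, 1, by simp, by simp⟩
  | add p q hp hq => simpa using hp.add hq
  | mul_X p j hp => simpa using hp.mul (hφ j)

theorem IsMorphism.comp {σ τ ρ : Type} {S : Set (σ → k)} {T : Set (τ → k)} {V : Set (ρ → k)}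
    {ψ : (τ → k) → (ρ → k)} {φ : (σ → k) → (τ → k)}
    (hψ : IsMorphism T V ψ) (hφ : IsMorphism S T φ) : IsMorphism S V (fun x => ψ (φ x)) := by
  refine ⟨fun x hx => hψ.1 (hφ.1 hx), fun j x hx => ?_⟩
  obtain ⟨p, q, hq, hpq⟩ := hψ.2 j (φ x) (hφ.1 hx)
  have hreg : ∀ i, IsRegularAt S x fun y => φ y i := fun i => hφ.2 i x hx
  exact IsRegularAt.of_div hx (isRegularAt_eval_comp hreg p) (isRegularAt_eval_comp hreg q) hq
    fun y hy hne => hpq (φ y) (hφ.1 hy) hne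

theorem isMorphism_of_eval {σ τ : Type} {S : Set (σ → k)} {T : Set (τ → k)}
    {φ : (σ → k) → (τ → k)} (h : Set.MapsTo φ S T)
    (hφ : ∀ j, ∃ p : MvPolynomial σ k, ∀ x, φ x j = eval x p) : IsMorphism S T φ := by
  refine ⟨h, fun j x _ => ?_⟩
  obtain ⟨p, hp⟩ := hφ j
  exact ⟨p, 1, by simp, fun y _ _ => by simp [hp]⟩

/-- Trivial fibrations compose: a product of `𝔸^d` and `𝔸^d'` is an `𝔸^(d + d')`. -/
theorem IsTrivialFibration.comp {σ τ ρ : Type} {T : Set (σ → k)} {S : Set (τ → k)}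
    {Q : Set (ρ → k)} {π₁ : (σ → k) → (τ → k)} {π₂ : (τ → k) → (ρ → k)} {d d' D : ℕ}
    (hD : d + d' = D) (h₁ : IsTrivialFibration T S π₁ d) (h₂ : IsTrivialFibration S Q π₂ d') :
    IsTrivialFibration T Q (fun x => π₂ (π₁ x)) D := by
  obtain ⟨hπ₁, Φ₁, Ψ₁, hΦ₁, hΨ₁, hl₁, hr₁, hc₁⟩ := h₁
  obtain ⟨hπ₂, Φ₂, Ψ₂, hΦ₂, hΨ₂, hl₂, hr₂, hc₂⟩ := h₂
  let ε : Fin d ⊕ Fin d' ≃ Fin D := finSumFinEquiv.trans (finCongr hD)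
  let Φ : (σ → k) → (ρ ⊕ Fin D → k) := fun x =>
    Sum.elim (fun r => Φ₂ (π₁ x) (Sum.inl r)) fun i =>
      Sum.elim (fun a => Φ₁ x (Sum.inr a)) (fun b => Φ₂ (π₁ x) (Sum.inr b)) (ε.symm i)
  let χ₂ : (ρ ⊕ Fin D → k) → (ρ ⊕ Fin d' → k) := fun z =>
    Sum.elim (fun r => z (Sum.inl r)) fun b => z (Sum.inr (ε (Sum.inr b)))
  let χ₁ : (ρ ⊕ Fin D → k) → (τ ⊕ Fin d → k) := fun z =>
    Sum.elim (Ψ₂ (χ₂ z)) fun a => z (Sum.inr (ε (Sum.inl a)))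
  have hχ₂ : IsMorphism (prodAffine Q D) (prodAffine Q d') χ₂ := by
    refine isMorphism_of_eval (fun z hz => hz) ?_
    rintro (r | b)
    · exact ⟨X (Sum.inl r), fun z => by simp [χ₂]⟩
    · exact ⟨X (Sum.inr (ε (Sum.inr b))), fun z => by simp [χ₂]⟩
  have hΨχ := hΨ₂.comp hχ₂
  have hχ₁ : IsMorphism (prodAffine Q D) (prodAffine S d) χ₁ := by
    refine ⟨fun z hz => hΨχ.1 hz, ?_⟩
    rintro (t | a)
    · exact hΨχ.2 t
    · exact fun z _ => ⟨X (Sum.inr (ε (Sum.inl a))), 1, by simp, fun y _ _ => by simp [χ₁]⟩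
  have hΦπ := hΦ₂.comp hπ₁
  have hpair : ∀ w : τ ⊕ Fin d → k,
      Sum.elim (fun s => w (Sum.inl s)) (fun a => w (Sum.inr a)) = w := fun w => by
    ext (_ | _) <;> rfl
  have hpair₂ : ∀ w : ρ ⊕ Fin d' → k,
      Sum.elim (fun s => w (Sum.inl s)) (fun a => w (Sum.inr a)) = w := fun w => by
    ext (_ | _) <;> rfl
  have hχΦ : ∀ x, χ₂ (Φ x) = Φ₂ (π₁ x) := fun x => by
    simp only [χ₂, Φ, Sum.elim_inl, Sum.elim_inr, Equiv.symm_apply_apply]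
    exact hpair₂ _
  refine ⟨hπ₂.comp hπ₁, Φ, fun z => Ψ₁ (χ₁ z), ⟨fun x hx => hΦπ.1 hx, ?_⟩, hΨ₁.comp hχ₁, ?_, ?_, ?_⟩
  · rintro (r | i)
    · exact hΦπ.2 (Sum.inl r)
    · rcases h : ε.symm i with a | b
      · have := hΦ₁.2 (Sum.inr a)
        simpa only [Φ, Sum.elim_inr, h, Sum.elim_inl] using this
      · have := hΦπ.2 (Sum.inr b)
        simpa only [Φ, Sum.elim_inr, h] using this
  · intro x hx
    have : χ₁ (Φ x) = Φ₁ x := by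
      rw [← hpair (Φ₁ x), hc₁ x hx]
      simp only [χ₁]
      rw [hχΦ, hl₂ _ (hπ₁.1 hx)]
      simp only [Φ, Sum.elim_inl, Sum.elim_inr, Equiv.symm_apply_apply]
    simp only [this]
    exact hl₁ x hx
  · intro z hz
    have hz₁ := hχ₁.1 hz
    have hz₂ := hχ₂.1 hz
    have e1 := hr₁ _ hz₁
    have e2 := hr₂ _ hz₂
    have hπ : π₁ (Ψ₁ (χ₁ z)) = Ψ₂ (χ₂ z) := by
      rw [← hc₁ _ (hΨ₁.1 hz₁), e1]
      rfl
    ext (r | i)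
    · simp only [Φ, Sum.elim_inl, hπ, e2]
      rfl
    · obtain ⟨(a | b), rfl⟩ := ε.surjective i
      · simp only [Φ, Sum.elim_inr, Equiv.symm_apply_apply, Sum.elim_inl, e1]
        rfl
      · simp only [Φ, Sum.elim_inr, Equiv.symm_apply_apply, hπ, e2]
        rfl
  · intro x hx
    simp only [Φ, Sum.elim_inl]
    exact hc₂ _ (hπ₁.1 hx)

/-! ### Taylor expansion and Hensel's lemma -/

theorem aeval_add_sub_mem {N : ℕ} {R : Type u} [CommRing R] [Algebra k R] (𝔞 : Ideal R)
    {x δ : Fin N → R} (hδ : ∀ j, δ j ∈ 𝔞) (p : MvPolynomial (Fin N) k) :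
    aeval (x + δ) p - aeval x p ∈ 𝔞 := by
  rw [← Ideal.Quotient.eq]
  change Ideal.Quotient.mkₐ k 𝔞 _ = Ideal.Quotient.mkₐ k 𝔞 _
  rw [MvPolynomial.comp_aeval_apply, MvPolynomial.comp_aeval_apply]
  congr 2
  ext j
  simpa using Ideal.Quotient.eq_zero_iff_mem.mpr (hδ j)

theorem aeval_add_sub_deriv_mem {N : ℕ} {R : Type u} [CommRing R] [Algebra k R] (𝔞 : Ideal R)
    {x δ : Fin N → R} (hδ : ∀ j, δ j ∈ 𝔞) (p : MvPolynomial (Fin N) k) :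
    aeval (x + δ) p - aeval x p - ∑ j, aeval x (pderiv j p) * δ j ∈ 𝔞 ^ 2 := by
  induction p using MvPolynomial.induction_on with
  | C a => simp
  | add p q hp hq =>
    convert add_mem hp hq using 1
    simp only [map_add, add_mul, Finset.sum_add_distrib]
    ring
  | mul_X p i hp =>
    set D := ∑ j, aeval x (pderiv j p) * δ j with hD
    have hsum : ∑ j, aeval x (pderiv j (p * X i)) * δ j = D * x i + aeval x p * δ i := by
      have : ∀ j, aeval x (pderiv j (p * X i)) * δ j =
          aeval x (pderiv j p) * δ j * x i + if i = j then aeval x p * δ j else 0 := by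
        intro j
        rw [pderiv_mul, pderiv_X, Pi.single_apply]
        split_ifs with h1
        · simp; ring
        · simp; ring
      simp only [this, Finset.sum_add_distrib, ← Finset.sum_mul, Finset.sum_ite_eq,
        Finset.mem_univ, if_true, hD]
    have hDmem : D ∈ 𝔞 := sum_mem fun j _ => Ideal.mul_mem_left _ _ (hδ j)
    rw [hsum]
    convert add_mem (Ideal.mul_mem_right (x i + δ i) _ hp)
      (show D * δ i ∈ 𝔞 ^ 2 by rw [pow_two]; exact Ideal.mul_mem_mul hDmem (hδ i)) using 1
    simp only [map_mul, aeval_X, Pi.add_apply]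
    ring

local notation "t" => (PowerSeries.X : PowerSeries k)

theorem mul_dvd_mulVec {ι κ R : Type*} [Fintype κ] [CommRing R] {A : Matrix ι κ R} {v : κ → R}
    {a b : R} (hA : ∀ i j, a ∣ A i j) (hv : ∀ j, b ∣ v j) (i : ι) : a * b ∣ A.mulVec v i := by
  change a * b ∣ ∑ j, A i j * v j
  exact Finset.dvd_sum fun j _ => mul_dvd_mul (hA i j) (hv j)

theorem dvd_mulVec {ι κ R : Type*} [Fintype κ] [CommRing R] (A : Matrix ι κ R) {v : κ → R}
    {b : R} (hv : ∀ j, b ∣ v j) (i : ι) : b ∣ A.mulVec v i := by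
  simpa using mul_dvd_mulVec (A := A) (fun i j => one_dvd _) hv i

/-- The values of the polynomials `f_1, …, f_m` at an arc on affine space. -/
def evalArc {N m : ℕ} {R : Type u} [CommRing R] [Algebra k R]
    (f : Fin m → MvPolynomial (Fin N) k) (a : Fin N → R) : Fin m → R :=
  fun i => aeval a (f i)

theorem dvd_jacobian_sub {N m a : ℕ} (f : Fin m → MvPolynomial (Fin N) k) {γ γ' : Arc k N}
    (h : ∀ j, t ^ a ∣ γ' j - γ j) (i : Fin m) (j : Fin N) :
    t ^ a ∣ jacobian f γ' i j - jacobian f γ i j := by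
  have := aeval_add_sub_mem (Ideal.span {t ^ a}) (x := γ) (δ := γ' - γ)
    (fun j => Ideal.mem_span_singleton.mpr (h j)) (pderiv j (f i))
  rwa [Ideal.mem_span_singleton, add_sub_cancel] at this

theorem dvd_evalArc_sub {N m a : ℕ} (f : Fin m → MvPolynomial (Fin N) k) {γ γ' : Arc k N}
    (h : ∀ j, t ^ a ∣ γ' j - γ j) (i : Fin m) :
    t ^ a ∣ evalArc f γ' i - evalArc f γ i := by
  have := aeval_add_sub_mem (Ideal.span {t ^ a}) (x := γ) (δ := γ' - γ)
    (fun j => Ideal.mem_span_singleton.mpr (h j)) (f i)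
  rwa [Ideal.mem_span_singleton, add_sub_cancel] at this

theorem dvd_evalArc_sub_deriv {N m a : ℕ} (f : Fin m → MvPolynomial (Fin N) k) (γ : Arc k N)
    {δ : Arc k N} (h : ∀ j, t ^ a ∣ δ j) (i : Fin m) :
    t ^ (2 * a) ∣ evalArc f (γ + δ) i - evalArc f γ i - (jacobian f γ).mulVec δ i := by
  have := aeval_add_sub_deriv_mem (Ideal.span {t ^ a}) (x := γ) (δ := δ)
    (fun j => Ideal.mem_span_singleton.mpr (h j)) (f i)
  rwa [Ideal.span_singleton_pow, Ideal.mem_span_singleton, ← pow_mul, mul_comm a 2] at this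

/-- A sequence of power series whose consecutive terms agree to higher and higher order has a
limit. -/
theorem exists_limit (u : ℕ → PowerSeries k) (a : ℕ)
    (h : ∀ n, t ^ (a + n) ∣ u (n + 1) - u n) : ∃ v, ∀ n, t ^ (a + n) ∣ v - u n := by
  have hmono : ∀ n r, t ^ (a + n) ∣ u (n + r) - u n := by
    intro n r
    induction r with
    | zero => simp
    | succ r ih =>
      have := dvd_add ((pow_dvd_pow t (by omega : a + n ≤ a + (n + r))).trans (h (n + r))) ih
      rwa [sub_add_sub_cancel] at this
  refine ⟨PowerSeries.mk fun c => PowerSeries.coeff c (u (c + 1)), fun n => ?_⟩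
  rw [PowerSeries.X_pow_dvd_iff]
  intro c hc
  rw [map_sub, PowerSeries.coeff_mk, sub_eq_zero]
  rcases le_total n (c + 1) with hn | hn
  · obtain ⟨r, hr⟩ := Nat.exists_eq_add_of_le hn
    have := PowerSeries.X_pow_dvd_iff.mp (hmono n r) c hc
    rwa [map_sub, sub_eq_zero, ← hr] at this
  · obtain ⟨r, hr⟩ := Nat.exists_eq_add_of_le hn
    have := PowerSeries.X_pow_dvd_iff.mp (hmono (c + 1) r) c (by omega)
    rw [map_sub, sub_eq_zero, ← hr] at this
    exact this.symm

theorem eq_zero_of_forall_X_pow_dvd {p : PowerSeries k} (h : ∀ n, t ^ n ∣ p) : p = 0 := by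
  ext n
  exact PowerSeries.X_pow_dvd_iff.mp (h (n + 1)) n (Nat.lt_succ_self n)

/-- Hensel's lemma: if the image of the Jacobian matrix at `γ₀` contains `t^e k[[t]]^m` and
`f(γ₀)` vanishes to an order `b > 2e`, then `γ₀` agrees modulo `t^(b-e)` with a zero of `f`. -/
theorem exists_arc_of_dvd {N m e b : ℕ} (f : Fin m → MvPolynomial (Fin N) k) (γ₀ : Arc k N)
    (W : Matrix (Fin N) (Fin m) (PowerSeries k)) (hW : jacobian f γ₀ * W = t ^ e • 1)
    (hb : 2 * e < b) (hf : ∀ i, t ^ b ∣ evalArc f γ₀ i) :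
    ∃ γ : Arc k N, evalArc f γ = 0 ∧ ∀ j, t ^ (b - e) ∣ γ j - γ₀ j := by
  let P : ℕ → Arc k N → Prop := fun n γ =>
    (∀ i, t ^ (b + n) ∣ evalArc f γ i) ∧ ∀ j, t ^ (b - e) ∣ γ j - γ₀ j
  have step : ∀ n γ, P n γ → ∃ γ', P (n + 1) γ' ∧ ∀ j, t ^ (b - e + n) ∣ γ' j - γ j := by
    rintro n γ ⟨h1, h2⟩
    have hz : ∀ i, ∃ z, evalArc f γ i = t ^ e * (t ^ (b - e + n) * z) := fun i => by
      obtain ⟨z, hz⟩ := h1 i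
      refine ⟨z, ?_⟩
      rw [hz, ← mul_assoc, ← pow_add]
      congr 2
      omega
    choose z hz using hz
    -- The Newton step uses the right inverse `W / t^e` of the Jacobian matrix at `γ₀`, not at `γ`;
    -- the error this makes has order at least `(b - e) + (b - e + n) ≥ b + n + 1`.
    let δ : Arc k N := -W.mulVec (fun i => t ^ (b - e + n) * z i)
    have hδ : ∀ j, t ^ (b - e + n) ∣ δ j := fun j => by
      refine dvd_neg.mpr ?_
      exact dvd_mulVec W (fun i => dvd_mul_right _ (z i)) j
    have hJδ : (jacobian f γ₀).mulVec δ = -evalArc f γ := by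
      simp only [δ]
      rw [Matrix.mulVec_neg, Matrix.mulVec_mulVec, hW]
      ext1 i
      simp [Matrix.smul_mulVec, hz]
    refine ⟨γ + δ, ⟨fun i => ?_, fun j => ?_⟩, fun j => by simpa using hδ j⟩
    · have hq := dvd_evalArc_sub_deriv f γ hδ i
      have hl : t ^ (b - e + (b - e + n)) ∣
          (jacobian f γ).mulVec δ i - (jacobian f γ₀).mulVec δ i := by
        rw [← Pi.sub_apply, ← Matrix.sub_mulVec, pow_add]
        exact mul_dvd_mulVec (fun i j => dvd_jacobian_sub f h2 i j) hδ i
      have := dvd_add ((pow_dvd_pow t (by omega : b + (n + 1) ≤ _)).trans hq)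
        ((pow_dvd_pow t (by omega : b + (n + 1) ≤ _)).trans hl)
      rw [hJδ] at this
      convert this using 1
      simp only [Pi.neg_apply]
      ring
    · have := dvd_add (h2 j) ((pow_dvd_pow t (by omega : b - e ≤ b - e + n)).trans (hδ j))
      convert this using 1
      simp only [Pi.add_apply]
      ring
  choose! next hnext using step
  let seq : ℕ → Arc k N := fun n => Nat.rec γ₀ (fun n γ => next n γ) n
  have hseq : ∀ n, P n (seq n) := by
    intro n
    induction n with
    | zero => exact ⟨hf, by simp [seq]⟩
    | succ n ih => exact (hnext n _ ih).1
  have hlim : ∀ j, ∃ v, ∀ n, t ^ (b - e + n) ∣ v - seq n j := fun j =>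
    exists_limit (fun n => seq n j) (b - e) fun n => (hnext n _ (hseq n)).2 j
  choose γ hγ using hlim
  refine ⟨γ, ?_, fun j => by simpa [seq] using hγ j 0⟩
  ext1 i
  refine eq_zero_of_forall_X_pow_dvd fun n => ?_
  have h1 := dvd_evalArc_sub f (fun j => hγ j n) i
  have := dvd_add ((pow_dvd_pow t (by omega : n ≤ _)).trans h1)
    ((pow_dvd_pow t (by omega : n ≤ _)).trans ((hseq n).1 i))
  rwa [sub_add_cancel] at this

/-! ### Submodules of `k[[t]]^N` and their invariant factors -/


theorem natCast_le_order_iff {n : ℕ} {p : PowerSeries k} : (n : ℕ∞) ≤ p.order ↔ t ^ n ∣ p := by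
  rw [PowerSeries.X_pow_dvd_iff]
  exact ⟨fun h i hi => PowerSeries.coeff_of_lt_order i (lt_of_lt_of_le (by exact_mod_cast hi) h),
    fun h => PowerSeries.nat_le_order _ _ h⟩

/-- Over a field, divisibility of power series is comparison of orders. -/
theorem dvd_of_order_le {p q : PowerSeries k} (h : p.order ≤ q.order) : p ∣ q := by
  by_cases hp : p = 0
  · subst hp
    rw [PowerSeries.order_zero, top_le_iff, PowerSeries.order_eq_top] at h
    simp [h]
  · obtain ⟨n, hn⟩ := ENat.ne_top_iff_exists.mp (mt PowerSeries.order_eq_top.mp hp)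
    have h1 : t ^ n ∣ p := natCast_le_order_iff.mp hn.le
    have h2 : t ^ n ∣ q := natCast_le_order_iff.mp (hn.le.trans h)
    obtain ⟨w, rfl⟩ := h1
    have hw : IsUnit w := by
      rw [PowerSeries.isUnit_iff_constantCoeff, isUnit_iff_ne_zero,
        ← PowerSeries.coeff_zero_eq_constantCoeff_apply]
      intro h0
      have h3 : t ∣ w := by
        rw [PowerSeries.X_dvd_iff, ← PowerSeries.coeff_zero_eq_constantCoeff_apply, h0]
      have h4 : t ^ (n + 1) ∣ t ^ n * w := by
        rw [pow_succ]
        exact mul_dvd_mul_left _ h3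
      rw [← natCast_le_order_iff, ← hn] at h4
      exact absurd (by exact_mod_cast h4 : n + 1 ≤ n) (by omega)
    exact (hw.mul_right_dvd).mpr h2

/-- The submodule of the vectors whose `j`-th coordinate has order at least `c j`. Since `c j = ⊤`
is allowed, the quotient by it can have free summands. -/
def orderSub {ι : Type*} (c : ι → ℕ∞) : Submodule (PowerSeries k) (ι → PowerSeries k) where
  carrier := {x | ∀ j, c j ≤ (x j).order}
  zero_mem' j := by simp
  add_mem' hx hy j := (le_min (hx j) (hy j)).trans (PowerSeries.min_order_le_order_add _ _)
  smul_mem' a x hx j := (hx j).trans (le_add_self.trans (PowerSeries.le_order_mul _ _))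

theorem mem_orderSub {ι : Type*} {c : ι → ℕ∞} {x : ι → PowerSeries k} :
    x ∈ orderSub c ↔ ∀ j, c j ≤ (x j).order := Iff.rfl

theorem mem_orderSub_natCast {ι : Type*} {c : ι → ℕ} {x : ι → PowerSeries k} :
    x ∈ orderSub (fun j => (c j : ℕ∞)) ↔ ∀ j, t ^ c j ∣ x j := by
  simp [mem_orderSub, natCast_le_order_iff]

theorem orderSub_sup {ι : Type*} (c d : ι → ℕ∞) :
    orderSub (k := k) c ⊔ orderSub d = orderSub (fun j => min (c j) (d j)) := by
  apply le_antisymm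
  · exact sup_le (fun x hx j => (min_le_left _ _).trans (hx j))
      (fun x hx j => (min_le_right _ _).trans (hx j))
  · intro x hx
    classical
    rw [Submodule.mem_sup]
    refine ⟨fun j => if c j ≤ d j then x j else 0, fun j => ?_,
      fun j => if c j ≤ d j then 0 else x j, fun j => ?_, ?_⟩
    · dsimp only
      split_ifs with h
      · simpa [h] using hx j
      · simp
    · dsimp only
      split_ifs with h
      · simp
      · simpa [(not_le.mp h).le] using hx j
    · ext1 j
      by_cases h : c j ≤ d j <;> simp [h]

theorem orderSub_const {ι : Type*} (q : ℕ) :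
    orderSub (k := k) (fun _ : ι => (q : ℕ∞)) = Ideal.span {t ^ q} • ⊤ := by
  ext x
  rw [Submodule.ideal_span_singleton_smul, Submodule.mem_smul_pointwise_iff_exists,
    mem_orderSub_natCast]
  constructor
  · intro h
    choose y hy using h
    exact ⟨y, trivial, funext fun j => (hy j).symm⟩
  · rintro ⟨y, -, rfl⟩ j
    exact dvd_mul_right _ _

/-- The dimension over `k` of `M / t^q M`, where `M = k[[t]]^N / L`. It is finite, so `finrank` does
not take a junk value. -/
def codim {N : ℕ} (q : ℕ) (L : Submodule (PowerSeries k) (Fin N → PowerSeries k)) : ℕ :=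
  Module.finrank k ((Fin N → PowerSeries k) ⧸ (L ⊔ orderSub fun _ => (q : ℕ∞)))

/-- `codim q L` only depends on the isomorphism class of the quotient by `L`, since
`k[[t]]^N / (L + t^q k[[t]]^N)` is the quotient modulo `t^q`. -/
theorem codim_eq_of_equiv {N : ℕ} {L L' : Submodule (PowerSeries k) (Fin N → PowerSeries k)}
    (h : Nonempty (((Fin N → PowerSeries k) ⧸ L) ≃ₗ[PowerSeries k] ((Fin N → PowerSeries k) ⧸ L')))
    (q : ℕ) : codim q L = codim q L' := by
  obtain ⟨ψ⟩ := h
  have key : ∀ L : Submodule (PowerSeries k) (Fin N → PowerSeries k),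
      Nonempty (((Fin N → PowerSeries k) ⧸ (L ⊔ orderSub fun _ => (q : ℕ∞)))
        ≃ₗ[PowerSeries k] (((Fin N → PowerSeries k) ⧸ L) ⧸
          (Ideal.span {t ^ q} • ⊤ : Submodule (PowerSeries k) ((Fin N → PowerSeries k) ⧸ L)))) := by
    intro L
    have e1 := Submodule.quotientQuotientEquivQuotientSup L (orderSub fun _ => (q : ℕ∞))
    refine ⟨e1.symm.trans (Submodule.quotEquivOfEq _ _ ?_)⟩
    rw [orderSub_const, Submodule.map_smul'', Submodule.map_top, Submodule.range_mkQ]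
  obtain ⟨e1⟩ := key L
  obtain ⟨e2⟩ := key L'
  have e3 := Submodule.Quotient.equiv
    (Ideal.span {t ^ q} • ⊤ : Submodule (PowerSeries k) ((Fin N → PowerSeries k) ⧸ L))
    (Ideal.span {t ^ q} • ⊤ : Submodule (PowerSeries k) ((Fin N → PowerSeries k) ⧸ L')) ψ
    (by rw [Submodule.map_smul'', Submodule.map_top, LinearEquiv.range])
  exact (((e1.trans e3).trans e2.symm).restrictScalars k).finrank_eq

theorem finrank_quotient_orderSub {N : ℕ} (c : Fin N → ℕ) :
    Module.finrank k ((Fin N → PowerSeries k) ⧸ orderSub (k := k) fun j => (c j : ℕ∞)) =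
      ∑ j, c j := by
  let φ : (Fin N → PowerSeries k) →ₗ[k] ((Σ j, Fin (c j)) → k) :=
    LinearMap.pi fun s => (PowerSeries.coeff (R := k) (s.2 : ℕ)).comp (LinearMap.proj s.1)
  have hφ : Function.Surjective φ := by
    intro y
    refine ⟨fun j => PowerSeries.mk fun n => if h : n < c j then y ⟨j, n, h⟩ else 0, ?_⟩
    ext ⟨j, n, hn⟩
    simp [φ, hn]
  have hker : LinearMap.ker φ = (orderSub fun j => (c j : ℕ∞)).restrictScalars k := by
    ext x
    rw [LinearMap.mem_ker, Submodule.restrictScalars_mem, mem_orderSub_natCast]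
    simp only [PowerSeries.X_pow_dvd_iff]
    constructor
    · intro h j n hn
      exact congrFun h ⟨j, n, hn⟩
    · intro h
      ext ⟨j, n, hn⟩
      exact h j n hn
  have e1 := (Submodule.quotEquivOfEq _ _ hker).symm.trans (φ.quotKerEquivOfSurjective hφ)
  have e2 := (Submodule.Quotient.restrictScalarsEquiv k
    (orderSub (k := k) fun j => (c j : ℕ∞))).symm.trans e1
  rw [e2.finrank_eq]
  simp

theorem codim_orderSub {N : ℕ} (c : Fin N → ℕ∞) (q : ℕ) :
    codim q (orderSub (k := k) c) = ∑ j, (min (c j) q).toNat := by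
  rw [codim, orderSub_sup, ← finrank_quotient_orderSub (k := k)]
  have : (fun j => min (c j) (q : ℕ∞)) = fun j => (((min (c j) (q : ℕ∞)).toNat : ℕ) : ℕ∞) := by
    ext1 j
    exact (ENat.natCast_toNat (ne_top_of_le_ne_top (ENat.natCast_ne_top q) (min_le_right _ _))).symm
  rw [← this]

/-- After an automorphism of `k[[t]]^N`, the submodule `L` becomes `orderSub c`. -/
def IsAdapted {N : ℕ} (c : Fin N → ℕ∞)
    (L : Submodule (PowerSeries k) (Fin N → PowerSeries k)) : Prop :=
  ∃ g : (Fin N → PowerSeries k) ≃ₗ[PowerSeries k] (Fin N → PowerSeries k),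
    ∀ x, x ∈ L ↔ g x ∈ orderSub c

theorem IsAdapted.nonempty_equiv {N : ℕ} {c : Fin N → ℕ∞}
    {L : Submodule (PowerSeries k) (Fin N → PowerSeries k)} (h : IsAdapted c L) :
    Nonempty (((Fin N → PowerSeries k) ⧸ L) ≃ₗ[PowerSeries k]
      ((Fin N → PowerSeries k) ⧸ orderSub (k := k) c)) := by
  obtain ⟨g, hg⟩ := h
  refine ⟨Submodule.Quotient.equiv _ _ g ?_⟩
  ext y
  rw [Submodule.mem_map]
  constructor
  · rintro ⟨x, hx, rfl⟩
    exact (hg x).mp hx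
  · intro hy
    exact ⟨g.symm y, (hg _).mpr (by simpa using hy), by simp⟩

theorem IsAdapted.reindex {N : ℕ} {c : Fin N → ℕ∞}
    {L : Submodule (PowerSeries k) (Fin N → PowerSeries k)} (h : IsAdapted c L)
    (τ : Equiv.Perm (Fin N)) : IsAdapted (c ∘ τ) L := by
  obtain ⟨g, hg⟩ := h
  refine ⟨g.trans (LinearEquiv.funCongrLeft _ _ τ), fun x => (hg x).trans ?_⟩
  simp only [mem_orderSub, LinearEquiv.trans_apply, LinearEquiv.funCongrLeft_apply,
    LinearMap.funLeft_apply, Function.comp_apply]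
  exact (τ.forall_congr_right (q := fun j => c j ≤ (g x j).order)).symm

/-- The Smith normal form of a submodule generated by `m` elements. Its rank is at most `m`, so at
least `N - m` of the orders are infinite. -/
theorem exists_isAdapted_span {N m : ℕ} (v : Fin m → Fin N → PowerSeries k) :
    ∃ c : Fin N → ℕ∞, IsAdapted c (Submodule.span (PowerSeries k) (Set.range v)) ∧
      N ≤ m + (Finset.univ.filter fun j => c j = ⊤).card := by
  classical
  set L := Submodule.span (PowerSeries k) (Set.range v) with hL
  obtain ⟨n, snf⟩ := L.smithNormalForm (Pi.basisFun (PowerSeries k) (Fin N))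
  let c : Fin N → ℕ∞ := Function.extend snf.f (fun i => (snf.a i).order) fun _ => ⊤
  have hc : ∀ i, c (snf.f i) = (snf.a i).order := fun i => snf.f.injective.extend_apply _ _ i
  have hc' : ∀ j, j ∉ Set.range snf.f → c j = ⊤ := fun j hj =>
    Function.extend_apply' _ _ _ fun ⟨i, hi⟩ => hj ⟨i, hi⟩
  refine ⟨c, ⟨snf.bM.equivFun, fun x => ⟨fun hx j => ?_, fun hx => ?_⟩⟩, ?_⟩
  · rw [Module.Basis.equivFun_apply]
    by_cases hj : j ∈ Set.range snf.f
    · obtain ⟨i, rfl⟩ := hj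
      have := snf.repr_apply_embedding_eq_repr_smul ⟨x, hx⟩ (i := i)
      rw [this, hc, map_smul, Finsupp.smul_apply, smul_eq_mul, PowerSeries.order_mul]
      exact le_self_add
    · rw [snf.repr_eq_zero_of_notMem_range ⟨x, hx⟩ hj]
      simp
  · have hw : ∀ i, ∃ w, snf.bM.repr x (snf.f i) = snf.a i * w := fun i =>
      dvd_of_order_le (by simpa [hc] using hx (snf.f i))
    choose w hw using hw
    have hsum : x = ∑ i, w i • (snf.bN i : Fin N → PowerSeries k) := by
      conv_lhs => rw [← snf.bM.sum_repr x]
      rw [← Finset.sum_subset (Finset.subset_univ (Finset.univ.map snf.f)), Finset.sum_map]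
      · refine Finset.sum_congr rfl fun i _ => ?_
        rw [hw, snf.snf, smul_smul, mul_comm]
      · intro j _ hj
        have hj' : j ∉ Set.range snf.f := by simpa using hj
        have := hx j
        rw [hc' j hj', top_le_iff, PowerSeries.order_eq_top, Module.Basis.equivFun_apply] at this
        rw [this, zero_smul]
    rw [hsum]
    exact Submodule.sum_mem _ fun i _ => Submodule.smul_mem _ _ (snf.bN i).2
  · have h1 : n ≤ m := by
      have h2 : Module.finrank (PowerSeries k) L ≤ m := by
        have := finrank_range_le_card (R := PowerSeries k) v
        simpa [Set.finrank] using this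
      rwa [Module.finrank_eq_card_basis snf.bN, Fintype.card_fin] at h2
    have h3 : (Finset.univ.map snf.f)ᶜ ⊆ Finset.univ.filter fun j => c j = ⊤ := by
      intro j hj
      have hj' : j ∉ Set.range snf.f := by simpa using hj
      simpa using hc' j hj'
    have h4 := Finset.card_le_card h3
    rw [Finset.card_compl, Finset.card_map, Finset.card_univ, Fintype.card_fin,
      Fintype.card_fin] at h4
    omega

/-- A family of natural numbers at most `Q` is determined up to a permutation by its truncated
sums. -/
theorem exists_perm_of_sum_min_eq {ι : Type*} [Fintype ι] (u v : ι → ℕ) (Q : ℕ)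
    (hu : ∀ j, u j ≤ Q) (hv : ∀ j, v j ≤ Q)
    (h : ∀ q ≤ Q, ∑ j, min (u j) q = ∑ j, min (v j) q) :
    ∃ τ : Equiv.Perm ι, ∀ j, u (τ j) = v j := by
  classical
  have hstep : ∀ (w : ι → ℕ) q, ∑ j, min (w j) (q + 1) =
      ∑ j, min (w j) q + (Finset.univ.filter fun j => q < w j).card := by
    intro w q
    rw [Finset.card_filter, ← Finset.sum_add_distrib]
    refine Finset.sum_congr rfl fun j _ => ?_
    split_ifs <;> omega
  -- Successive differences of the truncated sums count the terms greater than `q`.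
  have hgt : ∀ q, (Finset.univ.filter fun j => q < u j).card =
      (Finset.univ.filter fun j => q < v j).card := by
    intro q
    by_cases hq : q < Q
    · have h1 := hstep u q
      have h2 := hstep v q
      have h3 := h q hq.le
      have h4 := h (q + 1) hq
      omega
    · rw [Finset.filter_false_of_mem fun j _ => by have := hu j; omega,
        Finset.filter_false_of_mem fun j _ => by have := hv j; omega]
  have hsplit : ∀ (w : ι → ℕ) q, Fintype.card ι = (Finset.univ.filter fun j => w j = q).card +
      ((Finset.univ.filter fun j => q < w j).card + (Finset.univ.filter fun j => w j < q).card) := by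
    intro w q
    rw [Finset.card_filter, Finset.card_filter, Finset.card_filter, ← Finset.sum_add_distrib,
      ← Finset.sum_add_distrib, ← Finset.card_univ, Finset.card_eq_sum_ones]
    refine Finset.sum_congr rfl fun j _ => ?_
    split_ifs <;> omega
  have hlt : ∀ (w : ι → ℕ) q, (Finset.univ.filter fun j => w j < q + 1).card +
      (Finset.univ.filter fun j => q < w j).card = Fintype.card ι := by
    intro w q
    rw [Finset.card_filter, Finset.card_filter, ← Finset.sum_add_distrib, ← Finset.card_univ,
      Finset.card_eq_sum_ones]
    refine Finset.sum_congr rfl fun j _ => ?_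
    split_ifs <;> omega
  have heq : ∀ q, (Finset.univ.filter fun j => v j = q).card =
      (Finset.univ.filter fun j => u j = q).card := by
    intro q
    have h1 := hsplit u q
    have h2 := hsplit v q
    have h3 := hgt q
    rcases q with _ | q
    · simp only [Nat.not_lt_zero, Finset.filter_false, Finset.card_empty] at h1 h2
      omega
    · have h4 := hlt u q
      have h5 := hlt v q
      have h6 := hgt q
      omega
  refine ⟨Equiv.ofFiberEquiv (f := v) (g := u) fun q => Fintype.equivOfCardEq ?_, fun j =>
    Equiv.ofFiberEquiv_map _ j⟩
  rw [Fintype.card_subtype, Fintype.card_subtype]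
  exact heq q

/-! ### Matrices with prescribed invariant factors -/

/-- The orders `e_1, …, e_m, ∞, …, ∞` (`N` terms) which describe the module
`k[[t]]/(t^{e_1}) ⊕ ⋯ ⊕ k[[t]]/(t^{e_m}) ⊕ k[[t]]^{N-m}`. -/
def typeOrders (N : ℕ) {m : ℕ} (e : Fin m → ℕ) (j : Fin N) : ℕ∞ :=
  if h : (j : ℕ) < m then (e ⟨j, h⟩ : ℕ∞) else ⊤

theorem typeOrders_of_lt {N m : ℕ} (e : Fin m → ℕ) {j : Fin N} (h : (j : ℕ) < m) :
    typeOrders N e j = e ⟨j, h⟩ := dif_pos h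

theorem typeOrders_of_le {N m : ℕ} (e : Fin m → ℕ) {j : Fin N} (h : m ≤ (j : ℕ)) :
    typeOrders N e j = ⊤ := dif_neg (not_lt.mpr h)

theorem nonempty_equiv_quotient_typeOrders {N m : ℕ} (hmN : m ≤ N) (e : Fin m → ℕ) :
    Nonempty (((Fin N → PowerSeries k) ⧸ orderSub (k := k) (typeOrders N e)) ≃ₗ[PowerSeries k]
      (((i : Fin m) → CyclicModule k (e i)) × (Fin (N - m) → PowerSeries k))) := by
  let κ : Fin m ⊕ Fin (N - m) ≃ Fin N :=
    finSumFinEquiv.trans (finCongr (Nat.add_sub_cancel' hmN))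
  let φ₁ : (Fin N → PowerSeries k) →ₗ[PowerSeries k] ((i : Fin m) → CyclicModule k (e i)) :=
    LinearMap.pi fun i => (Submodule.mkQ _).comp (LinearMap.proj (κ (Sum.inl i)))
  let φ₂ : (Fin N → PowerSeries k) →ₗ[PowerSeries k] (Fin (N - m) → PowerSeries k) :=
    LinearMap.pi fun i => LinearMap.proj (κ (Sum.inr i))
  have hs : Function.Surjective (φ₁.prod φ₂) := by
    rintro ⟨y, z⟩
    have : ∀ i, ∃ w : PowerSeries k, Submodule.Quotient.mk w = y i := fun i =>
      Submodule.Quotient.mk_surjective _ (y i)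
    choose w hw using this
    refine ⟨fun j => Sum.elim w z (κ.symm j), Prod.ext ?_ ?_⟩
    · ext1 i
      simp [φ₁, ← hw]
    · ext1 i
      simp [φ₂]
  refine ⟨(Submodule.quotEquivOfEq _ _ ?_).trans ((φ₁.prod φ₂).quotKerEquivOfSurjective hs)⟩
  ext x
  rw [LinearMap.ker_prod, Submodule.mem_inf, LinearMap.mem_ker, LinearMap.mem_ker, mem_orderSub,
    ← κ.forall_congr_right, Sum.forall, funext_iff, funext_iff]
  refine and_congr (forall_congr' fun i => ?_) (forall_congr' fun i => ?_)
  · rw [typeOrders_of_lt e (show (κ (Sum.inl i) : ℕ) < m from i.2), natCast_le_order_iff]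
    change _ ↔ (Submodule.Quotient.mk (x (κ (Sum.inl i))) : CyclicModule k (e i)) = 0
    rw [Submodule.Quotient.mk_eq_zero, Ideal.mem_span_singleton]
    rfl
  · rw [typeOrders_of_le e (show m ≤ (κ (Sum.inr i) : ℕ) by simp [κ]), top_le_iff,
      PowerSeries.order_eq_top]
    rfl

theorem toNat_min_natCast (a b : ℕ) : (min (a : ℕ∞) b).toNat = min a b := by
  rw [← (Nat.mono_cast (α := ℕ∞)).map_min, ENat.toNat_natCast]

/-- The type of a submodule of `k[[t]]^N` with `m` generators is determined by finitely many of the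
numbers `codim q`. -/
theorem isAdapted_of_codim_eq {N m : ℕ} (hmN : m ≤ N) (e : Fin m → ℕ) {K : ℕ}
    (hK : ∀ i, e i < K) (v : Fin m → Fin N → PowerSeries k)
    (h : ∀ q ≤ K, codim q (Submodule.span (PowerSeries k) (Set.range v)) =
      codim q (orderSub (k := k) (typeOrders N e))) :
    IsAdapted (typeOrders N e) (Submodule.span (PowerSeries k) (Set.range v)) := by
  classical
  obtain ⟨c, hc, hcard⟩ := exists_isAdapted_span v
  have htrunc : ∀ (a : ℕ∞) (q : ℕ), q ≤ K → min (min a K).toNat q = (min a q).toNat := by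
    intro a q hq
    induction a using ENat.recTopCoe with
    | top => simp [hq]
    | coe a =>
      rw [toNat_min_natCast, toNat_min_natCast]
      omega
  have hle : ∀ a : ℕ∞, (min a K).toNat ≤ K := by
    intro a
    induction a using ENat.recTopCoe with
    | top => simp
    | coe a => rw [toNat_min_natCast]; omega
  obtain ⟨τ, hτ⟩ := exists_perm_of_sum_min_eq (fun j => (min (c j) K).toNat)
    (fun j => (min (typeOrders N e j) K).toNat) K (fun j => hle _) (fun j => hle _) (by
      intro q hq
      simp only [htrunc _ q hq]
      rw [← codim_orderSub (k := k), ← codim_orderSub (k := k), ← h q hq]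
      exact (codim_eq_of_equiv hc.nonempty_equiv q).symm)
  have hlt : ∀ j : Fin N, (j : ℕ) < m → c (τ j) = typeOrders N e j := by
    intro j hj
    have h1 := hτ j
    have h2 := hK ⟨j, hj⟩
    simp only [typeOrders_of_lt e hj] at h1 ⊢
    generalize c (τ j) = a at h1 ⊢
    induction a using ENat.recTopCoe with
    | top =>
      rw [toNat_min_natCast, min_eq_right le_top, ENat.toNat_natCast] at h1
      omega
    | coe a =>
      rw [toNat_min_natCast, toNat_min_natCast] at h1
      congr 1
      omega
  -- The infinite orders all lie among the last `N - m` ones, and there are at least `N - m` of them.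
  have hsub : (Finset.univ.filter fun j => c (τ j) = ⊤) ⊆
      Finset.univ.filter fun j : Fin N => m ≤ (j : ℕ) := by
    intro j hj
    simp only [Finset.mem_filter, Finset.mem_univ, true_and] at hj ⊢
    by_contra hjm
    rw [hlt j (not_le.mp hjm), typeOrders_of_lt e (not_le.mp hjm)] at hj
    exact ENat.natCast_ne_top _ hj
  have hcardτ : (Finset.univ.filter fun j => c (τ j) = ⊤).card =
      (Finset.univ.filter fun j => c j = ⊤).card := by
    rw [Finset.card_filter, Finset.card_filter]
    exact Equiv.sum_comp τ fun j => if c j = ⊤ then 1 else 0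
  have hcardm : (Finset.univ.filter fun j : Fin N => m ≤ (j : ℕ)).card = N - m := by
    have h1 := Finset.card_filter_add_card_filter_not (s := (Finset.univ : Finset (Fin N)))
      (fun j : Fin N => (j : ℕ) < m)
    simp only [not_lt] at h1
    rw [Fin.card_filter_val_lt, Finset.card_univ, Fintype.card_fin] at h1
    omega
  have heq := Finset.eq_of_subset_of_card_le hsub (by omega)
  have : c ∘ τ = typeOrders N e := by
    ext1 j
    rcases lt_or_ge (j : ℕ) m with hj | hj
    · exact hlt j hj
    · have : j ∈ Finset.univ.filter fun j => c (τ j) = ⊤ := by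
        rw [heq]
        simpa using hj
      rw [typeOrders_of_le e hj]
      simpa using this
  rw [← this]
  exact hc.reindex τ

/-- The row space of the matrix `J` has invariant factors `t^{e_1}, …, t^{e_m}`. -/
def HasType {N m : ℕ} (e : Fin m → ℕ) (J : Matrix (Fin m) (Fin N) (PowerSeries k)) : Prop :=
  IsAdapted (typeOrders N e) (Submodule.span (PowerSeries k) (Set.range fun i => J i))

/-- The type of a matrix in terms of the isomorphism class of the cokernel of its rows. -/
theorem hasType_iff_nonempty_equiv {N m : ℕ} (hmN : m ≤ N) (e : Fin m → ℕ)
    (J : Matrix (Fin m) (Fin N) (PowerSeries k)) :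
    HasType e J ↔
      Nonempty (((Fin N → PowerSeries k) ⧸ Submodule.span (PowerSeries k) (Set.range fun i => J i))
        ≃ₗ[PowerSeries k]
          (((i : Fin m) → CyclicModule k (e i)) × (Fin (N - m) → PowerSeries k))) := by
  obtain ⟨ψ⟩ := nonempty_equiv_quotient_typeOrders (k := k) hmN e
  constructor
  · intro h
    exact h.nonempty_equiv.map fun g => g.trans ψ
  · rintro ⟨g⟩
    exact isAdapted_of_codim_eq hmN e (K := lastExp e + 1)
      (fun i => Nat.lt_succ_of_le (Finset.le_sup (Finset.mem_univ i))) _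
      fun q _ => codim_eq_of_equiv ⟨g.trans ψ.symm⟩ q

/-- Being of type `e` amounts to finitely many equations between dimensions, each of which only
involves the matrix modulo a power of `t`. -/
theorem hasType_iff_codim {N m : ℕ} (hmN : m ≤ N) (e : Fin m → ℕ) {K : ℕ} (hK : ∀ i, e i < K)
    (J : Matrix (Fin m) (Fin N) (PowerSeries k)) :
    HasType e J ↔ ∀ q ≤ K, codim q (Submodule.span (PowerSeries k) (Set.range fun i => J i)) =
      codim q (orderSub (k := k) (typeOrders N e)) :=
  ⟨fun h q _ => codim_eq_of_equiv h.nonempty_equiv q,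
    fun h => isAdapted_of_codim_eq hmN e hK _ h⟩

theorem span_sup_orderSub_le {N m a q : ℕ} (hq : q ≤ a)
    {J J' : Matrix (Fin m) (Fin N) (PowerSeries k)} (h : ∀ i j, t ^ a ∣ J' i j - J i j) :
    Submodule.span (PowerSeries k) (Set.range fun i => J' i) ⊔ orderSub (fun _ => (q : ℕ∞)) ≤
      Submodule.span (PowerSeries k) (Set.range fun i => J i) ⊔ orderSub fun _ => (q : ℕ∞) := by
  refine sup_le (Submodule.span_le.mpr ?_) le_sup_right
  rintro _ ⟨i, rfl⟩
  have h1 : J' i - J i ∈ orderSub (k := k) fun _ : Fin N => (q : ℕ∞) :=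
    mem_orderSub_natCast.mpr fun j => (pow_dvd_pow t hq).trans (h i j)
  have h2 := Submodule.add_mem_sup (Submodule.subset_span (s := Set.range fun i => J i) ⟨i, rfl⟩) h1
  simpa using h2

/-- The type of a matrix only depends on its entries modulo `t^a`, for `a > e_m`. -/
theorem HasType.congr {N m a : ℕ} (hmN : m ≤ N) {e : Fin m → ℕ} (ha : ∀ i, e i < a)
    {J J' : Matrix (Fin m) (Fin N) (PowerSeries k)} (h : ∀ i j, t ^ a ∣ J' i j - J i j)
    (hJ : HasType e J) : HasType e J' := by
  rw [hasType_iff_codim hmN e ha] at hJ ⊢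
  intro q hq
  rw [← hJ q hq, codim, codim, le_antisymm (span_sup_orderSub_le hq h)
    (span_sup_orderSub_le hq fun i j => (dvd_sub_comm).mp (h i j))]

/-- A matrix of type `e` is `P * diag(t^{e_1}, …, t^{e_m}) * B`, where `P` is invertible and `B` has
a right inverse. -/
theorem HasType.exists_factorization {N m : ℕ} (hmN : m ≤ N) {e : Fin m → ℕ}
    {J : Matrix (Fin m) (Fin N) (PowerSeries k)} (hJ : HasType e J) :
    ∃ (P Q : Matrix (Fin m) (Fin m) (PowerSeries k)) (B : Matrix (Fin m) (Fin N) (PowerSeries k))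
      (C : Matrix (Fin N) (Fin m) (PowerSeries k)), Q * P = 1 ∧ B * C = 1 ∧
      J = P * Matrix.diagonal (fun i => t ^ e i) * B := by
  classical
  obtain ⟨g, hg⟩ := hJ
  have hrow : ∀ i j, typeOrders N e j ≤ (g (J i) j).order := fun i =>
    (hg (J i)).mp (Submodule.subset_span ⟨i, rfl⟩)
  have hP : ∀ i (l : Fin m), ∃ p, g (J i) (Fin.castLE hmN l) = t ^ e l * p := by
    intro i l
    have := hrow i (Fin.castLE hmN l)
    rwa [typeOrders_of_lt e (show (Fin.castLE hmN l : ℕ) < m from l.2),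
      natCast_le_order_iff] at this
  choose P hP using hP
  have hzero : ∀ i (j : Fin N), m ≤ (j : ℕ) → g (J i) j = 0 := by
    intro i j hj
    have := hrow i j
    rwa [typeOrders_of_le e hj, top_le_iff, PowerSeries.order_eq_top] at this
  let b : Fin m → Fin N → PowerSeries k := fun l => g.symm (Pi.single (Fin.castLE hmN l) 1)
  have hb : ∀ l, g (b l) = Pi.single (Fin.castLE hmN l) 1 := fun l => by simp [b]
  have hQ : ∀ l, ∃ Q : Fin m → PowerSeries k, ∑ i, Q i • J i = t ^ e l • b l := by
    intro l
    refine (Submodule.mem_span_range_iff_exists_fun _).mp ((hg _).mpr fun j => ?_)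
    rw [map_smul, hb]
    by_cases hj : j = Fin.castLE hmN l
    · subst hj
      rw [typeOrders_of_lt e (show (Fin.castLE hmN l : ℕ) < m from l.2), natCast_le_order_iff]
      simp
    · simp [hj]
  choose Q hQ using hQ
  refine ⟨Matrix.of P, Matrix.of Q, Matrix.of b,
    Matrix.of fun j l => g (Pi.single j 1) (Fin.castLE hmN l), ?_, ?_, ?_⟩
  · ext1 i l
    have h1 := congrFun (congrArg g (hQ i)) (Fin.castLE hmN l)
    simp only [map_sum, map_smul, Finset.sum_apply, Pi.smul_apply, smul_eq_mul, hP, hb] at h1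
    have h2 : t ^ e l * (Matrix.of Q * Matrix.of P) i l = t ^ e l * (1 : Matrix _ _ _) i l := by
      rw [Matrix.mul_apply, Finset.mul_sum]
      convert h1 using 1
      · refine Finset.sum_congr rfl fun r _ => ?_
        simp only [Matrix.of_apply]
        ring
      · rw [Matrix.one_apply, Pi.single_apply]
        by_cases hil : i = l
        · subst hil; simp
        · have : Fin.castLE hmN l ≠ Fin.castLE hmN i := fun h =>
            hil (Fin.castLE_injective hmN h).symm
          simp [hil, this]
    exact mul_left_cancel₀ (pow_ne_zero _ PowerSeries.X_ne_zero) h2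
  · ext1 i l
    have h1 : b i = ∑ j, b i j • (Pi.single j 1 : Fin N → PowerSeries k) := by
      ext1 r
      simp [Finset.sum_apply, Pi.single_apply]
    have h2 := congrFun (congrArg g h1) (Fin.castLE hmN l)
    simp only [map_sum, map_smul, Finset.sum_apply, Pi.smul_apply, smul_eq_mul] at h2
    rw [Matrix.mul_apply]
    simp only [Matrix.of_apply]
    rw [← h2, hb, Pi.single_apply, Matrix.one_apply]
    by_cases hil : i = l
    · subst hil; simp
    · have : Fin.castLE hmN l ≠ Fin.castLE hmN i := fun h =>
        hil (Fin.castLE_injective hmN h).symm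
      simp [hil, this]
  · have h1 : ∀ i, J i = ∑ l, (P i l * t ^ e l) • b l := by
      intro i
      apply g.injective
      ext1 j
      simp only [map_sum, map_smul, Finset.sum_apply, Pi.smul_apply, smul_eq_mul, hb]
      rcases lt_or_ge (j : ℕ) m with hj | hj
      · rw [Finset.sum_eq_single ⟨j, hj⟩]
        · have := hP i ⟨j, hj⟩
          simp only [Fin.castLE_mk, Fin.eta] at this
          rw [this]
          simp [mul_comm]
        · intro l _ hl
          have : j ≠ Fin.castLE hmN l := fun h => hl (by ext; simp [h])
          simp [this]
        · simp
      · rw [hzero i j hj, Finset.sum_eq_zero]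
        intro l _
        have : j ≠ Fin.castLE hmN l := fun h => by
          have := l.2
          simp [h] at hj
          omega
        simp [this]
    ext1 i j
    rw [h1 i, Matrix.mul_apply]
    simp [Finset.sum_apply, Matrix.mul_diagonal]

/-- For `J` of type `e` with all `e_i ≤ K`, the image of `J` contains `t^K k[[t]]^m`. -/
theorem HasType.exists_mul_eq {N m K : ℕ} (hmN : m ≤ N) {e : Fin m → ℕ} (hK : ∀ i, e i ≤ K)
    {J : Matrix (Fin m) (Fin N) (PowerSeries k)} (hJ : HasType e J) :
    ∃ W : Matrix (Fin N) (Fin m) (PowerSeries k), J * W = t ^ K • 1 := by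
  obtain ⟨P, Q, B, C, hQP, hBC, rfl⟩ := hJ.exists_factorization hmN
  refine ⟨C * Matrix.diagonal (fun i => t ^ (K - e i)) * Q, ?_⟩
  have h1 : Matrix.diagonal (fun i => t ^ e i) * Matrix.diagonal (fun i => t ^ (K - e i)) =
      t ^ K • (1 : Matrix (Fin m) (Fin m) (PowerSeries k)) := by
    rw [Matrix.diagonal_mul_diagonal, Matrix.smul_one_eq_diagonal]
    congr 1
    ext1 i
    rw [← pow_add, Nat.add_sub_cancel' (hK i)]
  calc _ = P * (Matrix.diagonal (fun i => t ^ e i) * (B * C) *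
          Matrix.diagonal (fun i => t ^ (K - e i))) * Q := by simp only [Matrix.mul_assoc]
    _ = _ := by
      rw [hBC, Matrix.mul_one, h1, Matrix.mul_smul, Matrix.smul_mul, Matrix.mul_one,
        mul_eq_one_comm.mp hQP]

/-- All maximal minors of a matrix of type `e` are divisible by `t^(e_1 + ⋯ + e_m)`. -/
theorem HasType.dvd_det_submatrix {N m : ℕ} (hmN : m ≤ N) {e : Fin m → ℕ}
    {J : Matrix (Fin m) (Fin N) (PowerSeries k)} (hJ : HasType e J) (α : Fin m → Fin N) :
    t ^ (∑ i, e i) ∣ (J.submatrix id α).det := by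
  obtain ⟨P, Q, B, C, -, -, rfl⟩ := hJ.exists_factorization hmN
  have : (P * Matrix.diagonal (fun i => t ^ e i) * B).submatrix id α =
      P * Matrix.diagonal (fun i => t ^ e i) * B.submatrix id α := rfl
  rw [this, Matrix.det_mul, Matrix.det_mul, Matrix.det_diagonal, Finset.prod_pow_eq_pow_sum]
  exact (dvd_mul_left _ _).mul_right _

/-- The Cauchy–Binet formula, summed over all (not only the increasing) choices of columns. -/
theorem det_mul_eq_sum_submatrix {R : Type*} [CommRing R] {N m : ℕ}
    (A : Matrix (Fin m) (Fin N) R) (C : Matrix (Fin N) (Fin m) R) :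
    (A * C).det = ∑ α : Fin m → Fin N, (∏ i, C (α i) i) * (A.submatrix id α).det := by
  rw [← Matrix.det_transpose]
  have h1 : (A * C).transpose = fun i => ∑ j, C j i • A.transpose j := by
    ext i r
    simp [Matrix.mul_apply, Finset.sum_apply, mul_comm]
  have h2 := (Matrix.detRowAlternating (R := R) (n := Fin m)).toMultilinearMap.map_sum
    (fun i j => C j i • A.transpose j)
  change Matrix.detRowAlternating.toMultilinearMap _ = _
  rw [h1, h2]
  refine Finset.sum_congr rfl fun α _ => ?_
  rw [MultilinearMap.map_smul_univ, smul_eq_mul, ← Matrix.det_transpose]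
  rfl

/-- Some maximal minor of a matrix of type `e` has order exactly `e_1 + ⋯ + e_m`. -/
theorem HasType.exists_coeff_det_ne_zero {N m : ℕ} (hmN : m ≤ N) {e : Fin m → ℕ}
    {J : Matrix (Fin m) (Fin N) (PowerSeries k)} (hJ : HasType e J) :
    ∃ α : Fin m → Fin N, PowerSeries.coeff (∑ i, e i) (J.submatrix id α).det ≠ 0 := by
  by_contra! hcon
  have hdvd : ∀ α : Fin m → Fin N, t ^ (∑ i, e i + 1) ∣ (J.submatrix id α).det := by
    intro α
    rw [PowerSeries.X_pow_dvd_iff]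
    intro c hc
    rcases Nat.lt_succ_iff_lt_or_eq.mp hc with h | rfl
    · exact PowerSeries.X_pow_dvd_iff.mp (hJ.dvd_det_submatrix hmN α) c h
    · exact hcon α
  obtain ⟨P, Q, B, C, hQP, hBC, hJeq⟩ := hJ.exists_factorization hmN
  have h1 : (J * C).det = P.det * t ^ ∑ i, e i := by
    rw [hJeq, Matrix.mul_assoc, hBC, Matrix.mul_one, Matrix.det_mul, Matrix.det_diagonal,
      Finset.prod_pow_eq_pow_sum]
  have h2 : t ^ (∑ i, e i + 1) ∣ (J * C).det := by
    rw [det_mul_eq_sum_submatrix]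
    exact Finset.dvd_sum fun α _ => Dvd.dvd.mul_left (hdvd α) _
  have h3 : Q.det * P.det = 1 := by rw [← Matrix.det_mul, hQP, Matrix.det_one]
  have h4 : t ^ (∑ i, e i) * t ∣ t ^ (∑ i, e i) * 1 := by
    have h5 := Dvd.dvd.mul_left h2 Q.det
    rwa [h1, ← mul_assoc, h3, one_mul, pow_succ, ← mul_one (t ^ ∑ i, e i), mul_assoc, one_mul] at h5
  have h5 := (mul_dvd_mul_iff_left (pow_ne_zero (∑ i, e i) PowerSeries.X_ne_zero)).mp h4
  rw [PowerSeries.X_dvd_iff] at h5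
  simp at h5

/-! ### Maximal minors of minimal order -/

theorem submatrix_eq_mul {R : Type*} [CommRing R] {N m : ℕ} (J : Matrix (Fin m) (Fin N) R)
    (α : Fin m → Fin N) :
    J.submatrix id α = J * (1 : Matrix (Fin N) (Fin N) R).submatrix id α := by
  ext i r
  simp [Matrix.mul_apply, Matrix.one_apply]

/-- By Cramer's rule, the entries of `adj(J_α) J` are maximal minors of `J` again. -/
theorem dvd_adjugate_mul {N m s : ℕ} {J : Matrix (Fin m) (Fin N) (PowerSeries k)}
    (h : ∀ α, t ^ s ∣ (J.submatrix id α).det) (α : Fin m → Fin N) (i : Fin m) (j : Fin N) :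
    t ^ s ∣ ((J.submatrix id α).adjugate * J) i j := by
  have h1 : ((J.submatrix id α).adjugate * J) i j =
      ((J.submatrix id α).adjugate.mulVec fun r => J r j) i := rfl
  rw [h1, ← Matrix.cramer_eq_adjugate_mulVec, Matrix.cramer_apply]
  convert h (Function.update α i j) using 2
  ext r c
  by_cases hc : c = i
  · subst hc; simp
  · simp [hc]

theorem exists_isUnit_of_coeff_ne_zero {s : ℕ} {p : PowerSeries k} (h : t ^ s ∣ p)
    (h0 : PowerSeries.coeff s p ≠ 0) : ∃ u, IsUnit u ∧ p = t ^ s * u := by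
  obtain ⟨u, rfl⟩ := h
  refine ⟨u, ?_, rfl⟩
  rw [PowerSeries.isUnit_iff_constantCoeff, isUnit_iff_ne_zero,
    ← PowerSeries.coeff_zero_eq_constantCoeff_apply]
  have := PowerSeries.coeff_X_pow_mul u s 0
  rw [zero_add] at this
  rwa [← this]

/-- The columns in a maximal minor of minimal order span the image of `J`. -/
theorem exists_eq_submatrix_mul {N m s : ℕ} {J : Matrix (Fin m) (Fin N) (PowerSeries k)}
    (h : ∀ α, t ^ s ∣ (J.submatrix id α).det) {α : Fin m → Fin N}
    (hα : PowerSeries.coeff s (J.submatrix id α).det ≠ 0) :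
    ∃ G : Matrix (Fin m) (Fin N) (PowerSeries k), J = J.submatrix id α * G := by
  obtain ⟨u, hu, hdet⟩ := exists_isUnit_of_coeff_ne_zero (h α) hα
  obtain ⟨v, hv⟩ := hu.exists_right_inv
  have hG := dvd_adjugate_mul h α
  choose G hG using hG
  refine ⟨v • Matrix.of G, ?_⟩
  have h1 : (J.submatrix id α).adjugate * J = t ^ s • Matrix.of G := by
    ext1 i j
    simp [hG]
  have h2 : t ^ s • (u • J) = t ^ s • (J.submatrix id α * Matrix.of G) := by
    rw [smul_smul, ← hdet, ← Matrix.mul_smul, ← h1, ← Matrix.mul_assoc, Matrix.mul_adjugate,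
      Matrix.smul_mul, Matrix.one_mul]
  have h3 : u • J = J.submatrix id α * Matrix.of G :=
    smul_right_injective _ (pow_ne_zero s PowerSeries.X_ne_zero) h2
  rw [Matrix.mul_smul, ← h3, smul_smul, mul_comm v u, hv, one_smul]

theorem dvd_adjugate_mulVec {N m s a : ℕ} {J : Matrix (Fin m) (Fin N) (PowerSeries k)}
    (h : ∀ α, t ^ s ∣ (J.submatrix id α).det) (α : Fin m → Fin N) {z : Fin m → PowerSeries k}
    (hz : ∃ w, z = t ^ a • J.mulVec w) (i : Fin m) :
    t ^ (a + s) ∣ (J.submatrix id α).adjugate.mulVec z i := by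
  obtain ⟨w, rfl⟩ := hz
  rw [Matrix.mulVec_smul, Matrix.mulVec_mulVec, pow_add]
  refine mul_dvd_mul_left _ ?_
  simpa using mul_dvd_mulVec (dvd_adjugate_mul h α) (fun j => one_dvd (w j)) i

/-- Cramer's rule decides membership in `t^a` times the image of `J`. -/
theorem exists_eq_smul_mulVec_iff {N m s a : ℕ} {J : Matrix (Fin m) (Fin N) (PowerSeries k)}
    (h : ∀ α, t ^ s ∣ (J.submatrix id α).det) {α : Fin m → Fin N}
    (hα : PowerSeries.coeff s (J.submatrix id α).det ≠ 0) (z : Fin m → PowerSeries k) :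
    (∃ w, z = t ^ a • J.mulVec w) ↔
      ∀ i, t ^ (a + s) ∣ (J.submatrix id α).adjugate.mulVec z i := by
  refine ⟨fun hz => dvd_adjugate_mulVec h α hz, fun hz => ?_⟩
  obtain ⟨u, hu, hdet⟩ := exists_isUnit_of_coeff_ne_zero (h α) hα
  obtain ⟨v, hv⟩ := hu.exists_right_inv
  choose y hy using hz
  have h1 : (J.submatrix id α).adjugate.mulVec z = t ^ (a + s) • y := funext hy
  have h2 : t ^ s • (u • z) = t ^ s • (t ^ a • (J.submatrix id α).mulVec y) := by
    rw [smul_smul, ← hdet, smul_smul, ← pow_add, add_comm s a, ← Matrix.mulVec_smul, ← h1,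
      Matrix.mulVec_mulVec, Matrix.mul_adjugate, Matrix.smul_mulVec, Matrix.one_mulVec]
  have h3 : u • z = t ^ a • (J.submatrix id α).mulVec y :=
    smul_right_injective _ (pow_ne_zero s PowerSeries.X_ne_zero) h2
  refine ⟨v • ((1 : Matrix (Fin N) (Fin N) (PowerSeries k)).submatrix id α).mulVec y, ?_⟩
  rw [Matrix.mulVec_smul, Matrix.mulVec_mulVec, ← submatrix_eq_mul, smul_comm, ← h3, smul_smul,
    mul_comm v u, hv, one_smul]

/-- If the image of `A` contains `t^K k[[t]]^m`, a perturbation of `A` modulo `t^(K+1)` is `A` times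
a matrix congruent to the identity modulo `t`. -/
theorem exists_eq_mul_one_add {ι κ : Type*} [Fintype ι] [Fintype κ] [DecidableEq ι] [DecidableEq κ]
    {K : ℕ} {A A' : Matrix ι κ (PowerSeries k)} {W : Matrix κ ι (PowerSeries k)}
    (hW : A * W = t ^ K • 1) (h : ∀ i j, t ^ (K + 1) ∣ A' i j - A i j) :
    ∃ M : Matrix κ κ (PowerSeries k), A' = A * (1 + t • M) := by
  choose D hD using h
  refine ⟨W * Matrix.of D, ?_⟩
  rw [Matrix.mul_add, Matrix.mul_one, Matrix.mul_smul, ← Matrix.mul_assoc, hW, Matrix.smul_mul,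
    Matrix.one_mul, smul_smul, ← pow_succ']
  ext1 i j
  simp [← hD]

/-- A perturbation of `J` modulo `t^(K+1)`, for `K ≥ e_m`, does not enlarge the image. -/
theorem HasType.exists_mulVec_eq {N m K : ℕ} (hmN : m ≤ N) {e : Fin m → ℕ} (hK : ∀ i, e i ≤ K)
    {J J' : Matrix (Fin m) (Fin N) (PowerSeries k)} (hJ : HasType e J)
    (h : ∀ i j, t ^ (K + 1) ∣ J' i j - J i j) (w : Fin N → PowerSeries k) :
    ∃ w', J'.mulVec w = J.mulVec w' := by
  obtain ⟨W, hW⟩ := hJ.exists_mul_eq hmN hK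
  obtain ⟨M, rfl⟩ := exists_eq_mul_one_add hW h
  exact ⟨(1 + t • M).mulVec w, by rw [Matrix.mulVec_mulVec]⟩

/-- The leading coefficients of the maximal minors of minimal order of a matrix of type `e` only
depend on the matrix modulo `t^(K+1)`, for `K ≥ e_m`, even when these minors have larger order. -/
theorem HasType.coeff_det_eq {N m K : ℕ} (hmN : m ≤ N) {e : Fin m → ℕ} (hK : ∀ i, e i ≤ K)
    {J J' : Matrix (Fin m) (Fin N) (PowerSeries k)} (hJ : HasType e J) (hJ' : HasType e J')
    (h : ∀ i j, t ^ (K + 1) ∣ J' i j - J i j) (α : Fin m → Fin N) :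
    PowerSeries.coeff (∑ i, e i) (J'.submatrix id α).det =
      PowerSeries.coeff (∑ i, e i) (J.submatrix id α).det := by
  have key : ∀ {J J' : Matrix (Fin m) (Fin N) (PowerSeries k)} (_ : HasType e J)
      (_ : ∀ i j, t ^ (K + 1) ∣ J' i j - J i j),
      PowerSeries.coeff (∑ i, e i) (J.submatrix id α).det ≠ 0 →
      PowerSeries.coeff (∑ i, e i) (J'.submatrix id α).det =
        PowerSeries.coeff (∑ i, e i) (J.submatrix id α).det := by
    intro J J' hJ h hα
    obtain ⟨W, hW⟩ := hJ.exists_mul_eq hmN hK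
    obtain ⟨G, hG⟩ := exists_eq_submatrix_mul (hJ.dvd_det_submatrix hmN) hα
    have hW' : J.submatrix id α * (G * W) = t ^ K • 1 := by
      rw [← Matrix.mul_assoc, ← hG, hW]
    obtain ⟨M, hM⟩ := exists_eq_mul_one_add (A' := J'.submatrix id α) hW' fun i j => h i (α j)
    obtain ⟨u, hu⟩ := hJ.dvd_det_submatrix hmN α
    have h1 : PowerSeries.constantCoeff (1 + t • M).det = 1 := by
      rw [RingHom.map_det]
      convert Matrix.det_one (R := k) (n := Fin m)
      ext i j
      simp [Matrix.one_apply, apply_ite]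
    rw [hM, Matrix.det_mul, hu, mul_assoc]
    have h2 : ∀ v : PowerSeries k, PowerSeries.coeff (∑ i, e i) (t ^ (∑ i, e i) * v) =
        PowerSeries.constantCoeff v := fun v => by
      have := PowerSeries.coeff_X_pow_mul v (∑ i, e i) 0
      rwa [zero_add, PowerSeries.coeff_zero_eq_constantCoeff_apply] at this
    rw [h2, h2, map_mul, h1, mul_one]
  by_cases hα : PowerSeries.coeff (∑ i, e i) (J.submatrix id α).det = 0
  · by_cases hα' : PowerSeries.coeff (∑ i, e i) (J'.submatrix id α).det = 0
    · rw [hα, hα']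
    · exact (key hJ' (fun i j => (dvd_sub_comm).mp (h i j)) hα').symm
  · exact key hJ h hα

/-! ### Lifting jets to arcs -/

/-- The image of the Jacobian matrix decides which arcs on affine space agree modulo `t^(l+1)` with
an arc on `X`. -/
theorem exists_arc_iff {N m l : ℕ} (hmN : m ≤ N) {e : Fin m → ℕ} (hl : ∀ i, e i ≤ l)
    (f : Fin m → MvPolynomial (Fin N) k) {γ₀ : Arc k N} (h : HasType e (jacobian f γ₀)) :
    (∃ γ : Arc k N, evalArc f γ = 0 ∧ ∀ j, t ^ (l + 1) ∣ γ j - γ₀ j) ↔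
      ∃ w, evalArc f γ₀ = t ^ (l + 1) • (jacobian f γ₀).mulVec w := by
  obtain ⟨W, hW⟩ := h.exists_mul_eq hmN hl
  constructor
  · rintro ⟨γ, hγ, hd⟩
    choose w hw using hd
    have hT := dvd_evalArc_sub_deriv f γ₀ (δ := γ - γ₀) (a := l + 1)
      (fun j => ⟨w j, hw j⟩)
    rw [add_sub_cancel, hγ] at hT
    choose z hz using hT
    have h1 : γ - γ₀ = t ^ (l + 1) • w := funext hw
    refine ⟨-w - W.mulVec (t • z), ?_⟩
    rw [Matrix.mulVec_sub, Matrix.mulVec_neg, Matrix.mulVec_mulVec, hW]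
    ext1 i
    have h2 := hz i
    rw [h1, Matrix.mulVec_smul] at h2
    simp only [Pi.smul_apply, Pi.sub_apply, Pi.neg_apply, Pi.zero_apply, Matrix.smul_mulVec,
      Matrix.one_mulVec, smul_eq_mul] at h2 ⊢
    have h3 : t ^ (2 * (l + 1)) = t ^ (l + 1) * (t ^ l * t) := by ring
    rw [h3] at h2
    linear_combination -h2
  · rintro ⟨w, hw⟩
    -- The linear correction makes `f` vanish to the order `2(l+1) > 2l`, where Hensel's lemma applies.
    set γ₁ : Arc k N := γ₀ - t ^ (l + 1) • w with hγ₁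
    have hd : ∀ j, t ^ (l + 1) ∣ γ₁ j - γ₀ j := fun j => by simp [hγ₁]
    have hJ₁ : HasType e (jacobian f γ₁) :=
      h.congr hmN (fun i => Nat.lt_succ_of_le (hl i)) (dvd_jacobian_sub f hd)
    obtain ⟨W₁, hW₁⟩ := hJ₁.exists_mul_eq hmN hl
    have hf : ∀ i, t ^ (2 * (l + 1)) ∣ evalArc f γ₁ i := by
      intro i
      have := dvd_evalArc_sub_deriv f γ₀ (δ := -(t ^ (l + 1) • w)) (a := l + 1)
        (fun j => by simp) i
      rw [Matrix.mulVec_neg, Matrix.mulVec_smul, ← hw, ← sub_eq_add_neg] at this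
      simpa using this
    obtain ⟨γ, hγ, hγd⟩ := exists_arc_of_dvd f γ₁ W₁ hW₁ (by omega : 2 * l < 2 * (l + 1)) hf
    refine ⟨γ, hγ, fun j => ?_⟩
    have := dvd_add ((pow_dvd_pow t (by omega : l + 1 ≤ _)).trans (hγd j)) (hd j)
    rwa [sub_add_sub_cancel] at this

/-- The polynomial arc `θ_1(t), …, θ_N(t)` whose components are those of the jet `θ`. -/
def liftJet {N n : ℕ} (θ : Jet k N n) : Arc k N := fun j =>
  ∑ i : Fin (n + 1), PowerSeries.C (θ (j, i)) * t ^ (i : ℕ)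

theorem coeff_liftJet {N n : ℕ} (θ : Jet k N n) (j : Fin N) (i : Fin (n + 1)) :
    PowerSeries.coeff (i : ℕ) (liftJet θ j) = θ (j, i) := by
  rw [liftJet, map_sum, Finset.sum_eq_single i]
  · simp
  · intro r _ hr
    rw [PowerSeries.coeff_C_mul, PowerSeries.coeff_X_pow, if_neg, mul_zero]
    exact fun h => hr (Fin.ext h.symm)
  · simp

theorem truncArc_eq_iff {N n : ℕ} (γ : Arc k N) (θ : Jet k N n) :
    truncArc n γ = θ ↔ ∀ j, t ^ (n + 1) ∣ γ j - liftJet θ j := by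
  simp only [PowerSeries.X_pow_dvd_iff, map_sub, sub_eq_zero]
  constructor
  · rintro rfl j c hc
    exact (coeff_liftJet (truncArc n γ) j ⟨c, hc⟩).symm
  · intro h
    ext ⟨j, i⟩
    rw [← coeff_liftJet θ j i, ← h j i i.2]
    rfl

theorem dvd_liftJet_truncJet_sub {N n l : ℕ} (h : l ≤ n) (θ : Jet k N n) (j : Fin N) :
    t ^ (l + 1) ∣ liftJet (truncJet h θ) j - liftJet θ j := by
  rw [PowerSeries.X_pow_dvd_iff]
  intro c hc
  rw [map_sub, sub_eq_zero]
  have h1 := coeff_liftJet (truncJet h θ) j ⟨c, hc⟩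
  have h2 := coeff_liftJet θ j ⟨c, by omega⟩
  simp only at h1 h2
  rw [h1, h2]
  rfl

theorem truncJet_truncArc {N n l : ℕ} (h : l ≤ n) (γ : Arc k N) :
    truncJet h (truncArc n γ) = truncArc l γ := rfl

theorem mem_arcs_iff {N m : ℕ} (f : Fin m → MvPolynomial (Fin N) k) (γ : Arc k N) :
    γ ∈ arcs (Ideal.span (Set.range f)) ↔ evalArc f γ = 0 := by
  constructor
  · intro h
    ext1 i
    exact h _ (Ideal.subset_span ⟨i, rfl⟩)
  · intro h p hp
    have : Ideal.span (Set.range f) ≤ RingHom.ker (aeval γ : MvPolynomial (Fin N) k →ₐ[k] _) := by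
      rw [Ideal.span_le]
      rintro _ ⟨i, rfl⟩
      exact congrFun h i
    exact this hp

theorem mem_arcsOfType_iff {N m : ℕ} (hmN : m ≤ N) (f : Fin m → MvPolynomial (Fin N) k)
    (e : Fin m → ℕ) (γ : Arc k N) :
    γ ∈ arcsOfType (Ideal.span (Set.range f)) f e ↔
      evalArc f γ = 0 ∧ HasType e (jacobian f γ) := by
  rw [arcsOfType, Set.mem_inter_iff, mem_arcs_iff, hasType_iff_nonempty_equiv hmN]
  rfl

theorem le_lastExp {m : ℕ} (e : Fin m → ℕ) (i : Fin m) : e i ≤ lastExp e :=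
  Finset.le_sup (Finset.mem_univ i)

/-- The criterion for lifting an `l`-jet to an arc on `X` of type `e`, in terms of any arc `γ₀` on
affine space above the jet. -/
theorem mem_truncatedArcs_iff_exists {N m l : ℕ} (hmN : m ≤ N)
    (f : Fin m → MvPolynomial (Fin N) k) {e : Fin m → ℕ} (hl : lastExp e ≤ l) (η : Jet k N l)
    {γ₀ : Arc k N} (hγ₀ : ∀ j, t ^ (l + 1) ∣ γ₀ j - liftJet η j) :
    η ∈ truncatedArcs l (Ideal.span (Set.range f)) f e ↔
      HasType e (jacobian f γ₀) ∧
        ∃ w, evalArc f γ₀ = t ^ (l + 1) • (jacobian f γ₀).mulVec w := by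
  have hle : ∀ i, e i ≤ l := fun i => (le_lastExp e i).trans hl
  have hlt : ∀ i, e i < l + 1 := fun i => Nat.lt_succ_of_le (hle i)
  constructor
  · rintro ⟨γ, hγ, hη⟩
    rw [mem_arcsOfType_iff hmN] at hγ
    rw [truncArc_eq_iff] at hη
    have hd : ∀ j, t ^ (l + 1) ∣ γ j - γ₀ j := fun j => by
      have := dvd_sub (hη j) (hγ₀ j)
      rwa [sub_sub_sub_cancel_right] at this
    have hT : HasType e (jacobian f γ₀) :=
      hγ.2.congr hmN hlt (dvd_jacobian_sub f fun j => (dvd_sub_comm).mp (hd j))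
    exact ⟨hT, (exists_arc_iff hmN hle f hT).mp ⟨γ, hγ.1, hd⟩⟩
  · rintro ⟨hT, hw⟩
    obtain ⟨γ, hγ, hd⟩ := (exists_arc_iff hmN hle f hT).mpr hw
    refine ⟨γ, (mem_arcsOfType_iff hmN f e γ).mpr ⟨hγ, ?_⟩, ?_⟩
    · exact hT.congr hmN hlt (dvd_jacobian_sub f hd)
    · rw [truncArc_eq_iff]
      intro j
      have := dvd_add (hd j) (hγ₀ j)
      rwa [sub_add_sub_cancel] at this

/-- The `l`-jets of arcs on `X` of type `e` are described, for `l ≥ e_m`, by conditions on their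
polynomial lifts. -/
theorem mem_truncatedArcs_iff {N m l : ℕ} (hmN : m ≤ N)
    (f : Fin m → MvPolynomial (Fin N) k) {e : Fin m → ℕ} (hl : lastExp e ≤ l) (η : Jet k N l) :
    η ∈ truncatedArcs l (Ideal.span (Set.range f)) f e ↔
      HasType e (jacobian f (liftJet η)) ∧
        ∃ w, evalArc f (liftJet η) = t ^ (l + 1) • (jacobian f (liftJet η)).mulVec w :=
  mem_truncatedArcs_iff_exists hmN f hl η fun j => by simp

/-! ### Polynomial families of power series -/

/-- A family of power series parametrized by the points of `k^σ`, all of whose coefficients are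
polynomial functions. -/
def IsPolyFamily {σ : Type} (F : (σ → k) → PowerSeries k) : Prop :=
  ∃ G : PowerSeries (MvPolynomial σ k), ∀ x, F x = PowerSeries.map (eval x) G

namespace IsPolyFamily

variable {σ : Type} {F F' : (σ → k) → PowerSeries k}

theorem exists_eval_eq_coeff (h : IsPolyFamily F) (c : ℕ) :
    ∃ p : MvPolynomial σ k, ∀ x, PowerSeries.coeff c (F x) = eval x p := by
  obtain ⟨G, hG⟩ := h
  exact ⟨PowerSeries.coeff c G, fun x => by rw [hG, PowerSeries.coeff_map]⟩

theorem const (a : PowerSeries k) : IsPolyFamily fun _ : σ → k => a := by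
  refine ⟨PowerSeries.map C a, fun x => ?_⟩
  ext n
  simp

theorem C_eval (p : MvPolynomial σ k) : IsPolyFamily fun x : σ → k => PowerSeries.C (eval x p) :=
  ⟨PowerSeries.C p, fun x => by simp⟩

theorem add (h : IsPolyFamily F) (h' : IsPolyFamily F') : IsPolyFamily fun x => F x + F' x := by
  obtain ⟨G, hG⟩ := h
  obtain ⟨G', hG'⟩ := h'
  exact ⟨G + G', fun x => by simp only [hG, hG', map_add]⟩

theorem mul (h : IsPolyFamily F) (h' : IsPolyFamily F') : IsPolyFamily fun x => F x * F' x := by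
  obtain ⟨G, hG⟩ := h
  obtain ⟨G', hG'⟩ := h'
  exact ⟨G * G', fun x => by simp only [hG, hG', map_mul]⟩

theorem sum {ι : Type*} (s : Finset ι) {F : ι → (σ → k) → PowerSeries k}
    (h : ∀ i, IsPolyFamily (F i)) : IsPolyFamily fun x => ∑ i ∈ s, F i x := by
  choose G hG using h
  exact ⟨∑ i ∈ s, G i, fun x => by rw [map_sum]; exact Finset.sum_congr rfl fun i _ => hG i x⟩

theorem aeval {N : ℕ} {γ : (σ → k) → Arc k N} (h : ∀ j, IsPolyFamily fun x => γ x j)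
    (p : MvPolynomial (Fin N) k) : IsPolyFamily fun x => MvPolynomial.aeval (γ x) p := by
  induction p using MvPolynomial.induction_on with
  | C a => simpa using const (σ := σ) (algebraMap k (PowerSeries k) a)
  | add p q hp hq => simpa using hp.add hq
  | mul_X p j hp => simpa using hp.mul (h j)

theorem det {m : ℕ} {A : (σ → k) → Matrix (Fin m) (Fin m) (PowerSeries k)}
    (h : ∀ i j, IsPolyFamily fun x => A x i j) : IsPolyFamily fun x => (A x).det := by
  choose G hG using h
  refine ⟨(Matrix.of G).det, fun x => ?_⟩
  rw [RingHom.map_det]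
  exact congrArg Matrix.det (Matrix.ext fun i j => hG i j x)

theorem adjugate_mulVec {m : ℕ} {A : (σ → k) → Matrix (Fin m) (Fin m) (PowerSeries k)}
    {z : (σ → k) → Fin m → PowerSeries k} (h : ∀ i j, IsPolyFamily fun x => A x i j)
    (hz : ∀ i, IsPolyFamily fun x => z x i) (i : Fin m) :
    IsPolyFamily fun x => (A x).adjugate.mulVec (z x) i := by
  simp only [← Matrix.cramer_eq_adjugate_mulVec, Matrix.cramer_apply]
  refine det fun r c => ?_
  by_cases hc : c = i
  · subst hc
    simpa using hz r
  · simpa [hc] using h r c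

theorem mulVec {ι κ : Type*} [Fintype κ] {A : (σ → k) → Matrix ι κ (PowerSeries k)}
    {z : (σ → k) → κ → PowerSeries k} (h : ∀ i j, IsPolyFamily fun x => A x i j)
    (hz : ∀ i, IsPolyFamily fun x => z x i) (i : ι) : IsPolyFamily fun x => (A x).mulVec (z x) i :=
  sum _ fun j => (h i j).mul (hz j)

end IsPolyFamily

theorem isPolyFamily_liftJet {σ : Type} {N n : ℕ} {θ : (σ → k) → Jet k N n}
    (h : ∀ s, ∃ p : MvPolynomial σ k, ∀ x, θ x s = eval x p) (j : Fin N) :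
    IsPolyFamily fun x => liftJet (θ x) j := by
  refine IsPolyFamily.sum _ fun i => IsPolyFamily.mul ?_ (IsPolyFamily.const _)
  obtain ⟨p, hp⟩ := h (j, i)
  simp only [hp]
  exact IsPolyFamily.C_eval p

/-! ### Semicontinuity and local closedness -/

/-- The rank of a family of vectors with polynomial coordinates is lower semicontinuous. -/
theorem isOpen_le_finrank_span {σ ι κ : Type} [Fintype ι] [Fintype κ]
    (w : (σ → k) → ι → κ → k) (hw : ∀ i c, ∃ p : MvPolynomial σ k, ∀ x, w x i c = eval x p)
    (d : ℕ) : @IsOpen (σ → k) (zariski k σ)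
      {x | d ≤ Module.finrank k (Submodule.span k (Set.range (w x)))} := by
  classical
  let : TopologicalSpace (σ → k) := zariski k σ
  rw [isOpen_iff_forall_mem_open]
  intro x₀ hx₀
  obtain ⟨r, hdr, g, hg, hli⟩ : ∃ r, d ≤ r ∧ ∃ g : Fin r → κ → k,
      (∀ i, g i ∈ Set.range (w x₀)) ∧ LinearIndependent k g := by
    obtain ⟨g, hg, -, hli⟩ := Submodule.exists_fun_fin_finrank_span_eq k (Set.range (w x₀))
    exact ⟨_, hx₀, g, hg, hli⟩
  choose β hβ using hg
  have hker : LinearMap.ker (Fintype.linearCombination k g) = ⊥ :=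
    LinearMap.ker_eq_bot.mpr (linearIndependent_iff_injective_fintypeLinearCombination.mp hli)
  obtain ⟨L, hL⟩ := LinearMap.exists_leftInverse_of_injective _ hker
  have hLg : ∀ i, L (g i) = Pi.single i 1 := by
    intro i
    have := LinearMap.congr_fun hL (Pi.single i 1)
    simpa using this
  choose p hp using hw
  -- The minor of the vectors `w x (β i)` which is cut out by the left inverse `L` at `x₀`.
  let A : Matrix (Fin r) (Fin r) (MvPolynomial σ k) := Matrix.of fun i j =>
    ∑ c, p (β i) c * C (L (Pi.single c 1) j)
  have hA : ∀ x, eval x A.det = (Matrix.of fun i j => L (w x (β i)) j).det := by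
    intro x
    rw [RingHom.map_det]
    congr 1
    ext i j
    have h1 : w x (β i) = ∑ c, w x (β i) c • (Pi.single c 1 : κ → k) := by
      ext1 c
      simp [Finset.sum_apply, Pi.single_apply]
    simp only [Matrix.of_apply]
    rw [h1, map_sum]
    simp only [RingHom.mapMatrix_apply, Matrix.map_apply, A, Matrix.of_apply, hp, Finset.sum_apply, map_sum,
      map_mul, eval_C, map_smul, Pi.smul_apply, smul_eq_mul]
  refine ⟨{x | eval x A.det ≠ 0}, fun x hx => ?_, isOpen_eval_ne_zero _, ?_⟩
  · rw [Set.mem_ofPred_eq, hA] at hx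
    have h1 := Matrix.linearIndependent_rows_of_det_ne_zero hx
    have h2 : LinearIndependent k fun i => w x (β i) := LinearIndependent.of_comp L h1
    have h3 := finrank_span_eq_card h2
    rw [Fintype.card_fin] at h3
    refine hdr.trans ?_
    rw [← h3]
    refine Submodule.finrank_mono (Submodule.span_mono ?_)
    rintro _ ⟨i, rfl⟩
    exact ⟨β i, rfl⟩
  · rw [Set.mem_ofPred_eq, hA]
    have : (Matrix.of fun i j => L (w x₀ (β i)) j) = 1 := by
      ext i j
      simp only [Matrix.of_apply]
      rw [hβ, hLg, Pi.single_apply, Matrix.one_apply]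
      simp only [eq_comm]
    rw [this, Matrix.det_one]
    exact one_ne_zero

/-- `codim q` of the span of `v` as the corank of the coefficient vectors of the `t^a v_i` modulo
`t^q`. -/
theorem codim_add_finrank_span {N m : ℕ} (q : ℕ) (v : Fin m → Fin N → PowerSeries k) :
    codim q (Submodule.span (PowerSeries k) (Set.range v)) +
      Module.finrank k (Submodule.span k (Set.range fun (s : Fin m × Fin q) (r : Fin N × Fin q) =>
        PowerSeries.coeff (r.2 : ℕ) (t ^ (s.2 : ℕ) * v s.1 r.1))) = N * q := by
  set L := Submodule.span (PowerSeries k) (Set.range v) with hL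
  let φ : (Fin N → PowerSeries k) →ₗ[k] (Fin N × Fin q → k) :=
    LinearMap.pi fun r => (PowerSeries.coeff (R := k) (r.2 : ℕ)).comp (LinearMap.proj r.1)
  have hφ : Function.Surjective φ := by
    intro y
    refine ⟨fun j => PowerSeries.mk fun n => if h : n < q then y (j, ⟨n, h⟩) else 0, ?_⟩
    ext ⟨j, n, hn⟩
    simp [φ, hn]
  have hker : LinearMap.ker φ = (orderSub fun _ => (q : ℕ∞)).restrictScalars k := by
    ext x
    rw [LinearMap.mem_ker, Submodule.restrictScalars_mem, mem_orderSub_natCast]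
    simp only [PowerSeries.X_pow_dvd_iff]
    constructor
    · intro h j n hn
      exact congrFun h (j, ⟨n, hn⟩)
    · intro h
      ext ⟨j, n, hn⟩
      exact h j n hn
  set V := Submodule.span k (Set.range fun (s : Fin m × Fin q) (r : Fin N × Fin q) =>
        PowerSeries.coeff (r.2 : ℕ) (t ^ (s.2 : ℕ) * v s.1 r.1)) with hV
  have hmap : (L.restrictScalars k).map φ = V := by
    apply le_antisymm
    · rw [Submodule.map_le_iff_le_comap]
      intro x hx
      obtain ⟨c, rfl⟩ := (Submodule.mem_span_range_iff_exists_fun _).mp hx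
      rw [Submodule.mem_comap, map_sum]
      refine Submodule.sum_mem _ fun i _ => ?_
      have h1 : φ (c i • v i) = ∑ a : Fin q, PowerSeries.coeff (a : ℕ) (c i) •
          fun r : Fin N × Fin q => PowerSeries.coeff (r.2 : ℕ) (t ^ (a : ℕ) * v i r.1) := by
        ext ⟨j, n⟩
        have h2 : PowerSeries.coeff (n : ℕ) (c i * v i j) = ∑ a : Fin q,
            PowerSeries.coeff (a : ℕ) (c i) *
              PowerSeries.coeff (n : ℕ) (t ^ (a : ℕ) * v i j) := by
          have h3 : t ^ q ∣ c i - ∑ a : Fin q,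
              PowerSeries.C (PowerSeries.coeff (a : ℕ) (c i)) * t ^ (a : ℕ) := by
            rw [PowerSeries.X_pow_dvd_iff]
            intro b hb
            rw [map_sub, map_sum, Finset.sum_eq_single ⟨b, hb⟩]
            · simp
            · intro a _ ha
              rw [PowerSeries.coeff_C_mul, PowerSeries.coeff_X_pow, if_neg, mul_zero]
              exact fun h => ha (Fin.ext h.symm)
            · simp
          have h4 := PowerSeries.X_pow_dvd_iff.mp (h3.mul_right (v i j)) n n.2
          rw [sub_mul, map_sub, sub_eq_zero, Finset.sum_mul, map_sum] at h4
          rw [h4]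
          refine Finset.sum_congr rfl fun a _ => ?_
          rw [mul_assoc, PowerSeries.coeff_C_mul]
        simpa [φ, Finset.sum_apply] using h2
      rw [h1]
      exact Submodule.sum_mem _ fun a _ => Submodule.smul_mem _ _
        (Submodule.subset_span ⟨(i, a), rfl⟩)
    · rw [hV, Submodule.span_le]
      rintro _ ⟨⟨i, a⟩, rfl⟩
      refine ⟨t ^ (a : ℕ) • v i, Submodule.smul_mem L _ (Submodule.subset_span ⟨i, rfl⟩), ?_⟩
      ext ⟨j, n⟩
      simp [φ]
  have hker' : LinearMap.ker (V.mkQ.comp φ) =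
      (L ⊔ orderSub fun _ => (q : ℕ∞)).restrictScalars k := by
    rw [LinearMap.ker_comp, Submodule.ker_mkQ, ← hmap, Submodule.comap_map_eq, hker]
    ext x
    simp only [Submodule.restrictScalars_mem, Submodule.mem_sup]
  have hs : Function.Surjective (V.mkQ.comp φ) := by
    rw [LinearMap.coe_comp]
    exact (Submodule.mkQ_surjective V).comp hφ
  have e1 := (Submodule.quotEquivOfEq _ _ hker').symm.trans
    ((V.mkQ.comp φ).quotKerEquivOfSurjective hs)
  have e2 := (Submodule.Quotient.restrictScalarsEquiv k
    (L ⊔ orderSub fun _ => (q : ℕ∞))).symm.trans e1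
  rw [codim, e2.finrank_eq, Submodule.finrank_quotient_add_finrank]
  simp

/-- The set of points of a polynomial family of matrices at which the matrix is of type `e` is
locally closed. -/
theorem isLocallyClosed_hasType {σ : Type} {N m : ℕ} (hmN : m ≤ N) (e : Fin m → ℕ)
    (J : (σ → k) → Matrix (Fin m) (Fin N) (PowerSeries k))
    (hJ : ∀ i j, IsPolyFamily fun x => J x i j) :
    @IsLocallyClosed (σ → k) (zariski k σ) {x | HasType e (J x)} := by
  let : TopologicalSpace (σ → k) := zariski k σ
  set rk : ℕ → (σ → k) → ℕ := fun q x => Module.finrank k (Submodule.span k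
    (Set.range fun (s : Fin m × Fin q) (r : Fin N × Fin q) =>
      PowerSeries.coeff (r.2 : ℕ) (t ^ (s.2 : ℕ) * J x s.1 r.1))) with hrk
  have hopen : ∀ q d, IsOpen {x | d ≤ rk q x} := fun q d =>
    isOpen_le_finrank_span (fun x (s : Fin m × Fin q) (r : Fin N × Fin q) =>
      PowerSeries.coeff (r.2 : ℕ) (t ^ (s.2 : ℕ) * J x s.1 r.1)) (fun s r =>
      ((IsPolyFamily.const (t ^ (s.2 : ℕ))).mul (hJ s.1 r.1)).exists_eval_eq_coeff r.2) d
  have hsum : ∀ q x, codim q (Submodule.span (PowerSeries k) (Set.range fun i => J x i)) +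
      rk q x = N * q := fun q x => codim_add_finrank_span q _
  have hlt : ∀ i, e i < lastExp e + 1 := fun i => Nat.lt_succ_of_le (le_lastExp e i)
  set D : ℕ → ℕ := fun q => codim q (orderSub (k := k) (typeOrders N e)) with hD
  have hset : {x | HasType e (J x)} =
      (⋂ q ∈ Set.Iic (lastExp e + 1), {x | N * q - D q ≤ rk q x}) ∩
        ⋂ q ∈ Set.Iic (lastExp e + 1), {x | N * q + 1 - D q ≤ rk q x}ᶜ := by
    ext x
    simp only [Set.mem_ofPred_eq, hasType_iff_codim hmN e hlt, Set.mem_inter_iff, Set.mem_iInter,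
      Set.mem_Iic, Set.mem_compl_iff, ← forall_and]
    refine forall_congr' fun q => forall_congr' fun _ => ?_
    have := hsum q x
    change _ = D q ↔ _
    omega
  rw [hset]
  exact ((Set.finite_Iic _).isOpen_biInter fun q _ => hopen q _).isLocallyClosed.inter
    (isClosed_biInter fun q _ => (hopen q _).isClosed_compl).isLocallyClosed

theorem isPolyFamily_jacobian {σ : Type} {N m : ℕ} (f : Fin m → MvPolynomial (Fin N) k)
    {γ : (σ → k) → Arc k N} (h : ∀ j, IsPolyFamily fun x => γ x j) (i : Fin m) (j : Fin N) :
    IsPolyFamily fun x => jacobian f (γ x) i j :=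
  IsPolyFamily.aeval h _

theorem isPolyFamily_evalArc {σ : Type} {N m : ℕ} (f : Fin m → MvPolynomial (Fin N) k)
    {γ : (σ → k) → Arc k N} (h : ∀ j, IsPolyFamily fun x => γ x j) (i : Fin m) :
    IsPolyFamily fun x => evalArc f (γ x) i :=
  IsPolyFamily.aeval h _

/-- Among the jets whose lift has type `e`, those which lift to arcs on `X` are cut out by polynomial
equations: Cramer's rule for all choices `α` of columns, including those whose minor does not have
the minimal order, which give necessary conditions only. -/
theorem isLocClosed_truncatedArcs {N m l : ℕ} (hmN : m ≤ N)
    (f : Fin m → MvPolynomial (Fin N) k) {e : Fin m → ℕ} (hl : lastExp e ≤ l) :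
    IsLocClosed (truncatedArcs l (Ideal.span (Set.range f)) f e) := by
  let : TopologicalSpace (Jet k N l) := zariski k (Fin N × Fin (l + 1))
  have hlift : ∀ j, IsPolyFamily fun η : Jet k N l => liftJet η j :=
    isPolyFamily_liftJet fun s => ⟨X s, fun x => by simp⟩
  set s := ∑ i, e i with hs
  have hpoly : ∀ (α : Fin m → Fin N) i c, ∃ p : MvPolynomial (Fin N × Fin (l + 1)) k,
      ∀ η : Jet k N l, PowerSeries.coeff c
        (((jacobian f (liftJet η)).submatrix id α).adjugate.mulVec
          (evalArc f (liftJet η)) i) = eval η p := fun α i c =>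
    (IsPolyFamily.adjugate_mulVec (fun i j => isPolyFamily_jacobian f hlift i (α j))
      (isPolyFamily_evalArc f hlift) i).exists_eval_eq_coeff c
  choose p hp using hpoly
  have hset : truncatedArcs l (Ideal.span (Set.range f)) f e =
      {η | HasType e (jacobian f (liftJet η))} ∩
        zeroSet {r | ∃ α i c, c < l + 1 + s ∧ r = p α i c} := by
    ext η
    rw [mem_truncatedArcs_iff hmN f hl, Set.mem_inter_iff, Set.mem_ofPred_eq]
    refine and_congr_right fun hT => ?_
    have h1 : η ∈ zeroSet {r | ∃ α i c, c < l + 1 + s ∧ r = p α i c} ↔ ∀ α i,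
        t ^ (l + 1 + s) ∣ ((jacobian f (liftJet η)).submatrix id α).adjugate.mulVec
          (evalArc f (liftJet η)) i := by
      simp only [PowerSeries.X_pow_dvd_iff, hp]
      constructor
      · intro h α i c hc
        exact h _ ⟨α, i, c, hc, rfl⟩
      · rintro h _ ⟨α, i, c, hc, rfl⟩
        exact h α i c hc
    rw [h1]
    obtain ⟨α, hα⟩ := hT.exists_coeff_det_ne_zero hmN
    exact ⟨fun hw α i => dvd_adjugate_mulVec (hT.dvd_det_submatrix hmN) α hw i,
      fun h => (exists_eq_smul_mulVec_iff (hT.dvd_det_submatrix hmN) hα _).mpr (h α)⟩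
  rw [hset]
  exact (isLocallyClosed_hasType hmN e _ (isPolyFamily_jacobian f hlift)).inter
    (isClosed_zeroSet _).isLocallyClosed

/-! ### The type of a jet -/

theorem IsAdapted.sup_orderSub {N : ℕ} {c : Fin N → ℕ∞}
    {L : Submodule (PowerSeries k) (Fin N → PowerSeries k)} (h : IsAdapted c L) (q : ℕ) :
    IsAdapted (fun j => min (c j) q) (L ⊔ orderSub fun _ => (q : ℕ∞)) := by
  obtain ⟨g, hg⟩ := h
  have h1 : L = (orderSub c).map (g.symm : (Fin N → PowerSeries k) →ₗ[PowerSeries k] _) := by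
    ext x
    rw [hg, Submodule.map_equiv_eq_comap_symm]
    simp
  have h2 : orderSub (fun _ : Fin N => (q : ℕ∞)) = (orderSub fun _ : Fin N => (q : ℕ∞)).map
      (g.symm : (Fin N → PowerSeries k) →ₗ[PowerSeries k] _) := by
    rw [orderSub_const, Submodule.map_smul'', Submodule.map_top, LinearEquiv.range]
  refine ⟨g, fun x => ?_⟩
  rw [h1, h2, ← Submodule.map_sup, orderSub_sup, Submodule.map_equiv_eq_comap_symm]
  simp

theorem aeval_comp_eq {N n : ℕ} (θ : Jet k N n) (p : MvPolynomial (Fin N) k) :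
    aeval θ.comp p = Ideal.Quotient.mkₐ k (Ideal.span {t ^ (n + 1)}) (aeval (liftJet θ) p) := by
  rw [MvPolynomial.comp_aeval_apply]
  rfl

theorem mem_jets_iff {N m n : ℕ} (f : Fin m → MvPolynomial (Fin N) k) (θ : Jet k N n) :
    θ ∈ jets (Ideal.span (Set.range f)) n ↔ ∀ i, t ^ (n + 1) ∣ evalArc f (liftJet θ) i := by
  have h1 : ∀ p : MvPolynomial (Fin N) k,
      aeval θ.comp p = 0 ↔ t ^ (n + 1) ∣ aeval (liftJet θ) p := fun p => by
    rw [aeval_comp_eq, Ideal.Quotient.mkₐ_eq_mk, Ideal.Quotient.eq_zero_iff_mem,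
      Ideal.mem_span_singleton]
  constructor
  · intro h i
    exact (h1 _).mp (h _ (Ideal.subset_span ⟨i, rfl⟩))
  · intro h p hp
    have : Ideal.span (Set.range f) ≤
        RingHom.ker (aeval θ.comp : MvPolynomial (Fin N) k →ₐ[k] _) := by
      rw [Ideal.span_le]
      rintro _ ⟨i, rfl⟩
      exact (h1 _).mpr (h i)
    exact this hp

/-- Reduction of vectors modulo `t^{E_1}, …, t^{E_N}`. -/
def reduceVec {N : ℕ} (E : Fin N → ℕ) :
    (Fin N → PowerSeries k) →ₗ[PowerSeries k] ((j : Fin N) → CyclicModule k (E j)) :=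
  LinearMap.pi fun j => (Submodule.mkQ _).comp (LinearMap.proj j)

theorem reduceVec_surjective {N : ℕ} (E : Fin N → ℕ) :
    Function.Surjective (reduceVec (k := k) E) := by
  intro y
  have : ∀ j, ∃ w : PowerSeries k, Submodule.Quotient.mk w = y j := fun j =>
    Submodule.Quotient.mk_surjective _ (y j)
  choose w hw using this
  exact ⟨w, funext hw⟩

theorem ker_reduceVec {N : ℕ} (E : Fin N → ℕ) :
    LinearMap.ker (reduceVec (k := k) E) = orderSub fun j => (E j : ℕ∞) := by
  ext x
  rw [LinearMap.mem_ker, mem_orderSub_natCast, funext_iff]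
  refine forall_congr' fun j => ?_
  change (Submodule.Quotient.mk (x j) : CyclicModule k (E j)) = 0 ↔ _
  rw [Submodule.Quotient.mk_eq_zero, Ideal.mem_span_singleton]

theorem nonempty_jetModule_equiv {N m n : ℕ} (f : Fin m → MvPolynomial (Fin N) k)
    (θ : Jet k N n) :
    Nonempty (((Fin N → PowerSeries k) ⧸
      (Submodule.span (PowerSeries k) (Set.range fun i => jacobian f (liftJet θ) i) ⊔
        orderSub fun _ => ((n + 1 : ℕ) : ℕ∞))) ≃ₗ[PowerSeries k] jetModule f θ) := by
  let φ : (Fin N → PowerSeries k) →ₗ[PowerSeries k] (Fin N → TruncRing k n) :=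
    reduceVec fun _ => n + 1
  have hφ : Function.Surjective φ := reduceVec_surjective _
  set L := Submodule.span (PowerSeries k) (Set.range fun i => jacobian f (liftJet θ) i) with hL
  set V := Submodule.span (PowerSeries k) (Set.range fun i => jacobian f θ.comp i) with hV
  have hmap : L.map φ = V := by
    rw [hL, Submodule.map_span, ← Set.range_comp]
    congr 2
    ext1 i
    ext1 j
    exact (aeval_comp_eq θ (pderiv j (f i))).symm
  have hker : LinearMap.ker (V.mkQ.comp φ) = L ⊔ orderSub fun _ => ((n + 1 : ℕ) : ℕ∞) := by
    rw [LinearMap.ker_comp, Submodule.ker_mkQ, ← hmap, Submodule.comap_map_eq, ker_reduceVec]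
  exact ⟨(Submodule.quotEquivOfEq _ _ hker.symm).trans
    ((V.mkQ.comp φ).quotKerEquivOfSurjective ((Submodule.mkQ_surjective V).comp hφ))⟩

theorem codim_sup_orderSub {N q r : ℕ} (h : q ≤ r)
    (L : Submodule (PowerSeries k) (Fin N → PowerSeries k)) :
    codim q (L ⊔ orderSub fun _ => (r : ℕ∞)) = codim q L := by
  have : (L ⊔ orderSub fun _ => (r : ℕ∞)) ⊔ orderSub (fun _ => (q : ℕ∞)) =
      L ⊔ orderSub fun _ => (q : ℕ∞) := by
    have h1 : orderSub (k := k) (fun _ : Fin N => (r : ℕ∞)) ≤ orderSub fun _ => (q : ℕ∞) :=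
      fun x hx j => le_trans (Nat.cast_le.mpr h) (hx j)
    rw [sup_assoc, sup_eq_right.mpr h1]
  rw [codim, codim, this]

/-- The condition on the exponents of a jet `θ` says exactly that its polynomial lift has type `e`.
The bound on the exponent after `e_m` is automatic: the module of `θ` has only `m` relations besides
`t^(n+1)`, so the last `N - m` exponents are all equal to `n + 1`. -/
theorem mem_ambientJetsOfType_iff {N m n : ℕ} (hmN : m ≤ N) (f : Fin m → MvPolynomial (Fin N) k)
    {e : Fin m → ℕ} (he : Monotone e) (hn : ∀ i, e i ≤ n) (θ : Jet k N n) :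
    θ ∈ ambientJetsOfType n f e ↔ HasType e (jacobian f (liftJet θ)) := by
  classical
  obtain ⟨ψ⟩ := nonempty_jetModule_equiv f θ
  set J := jacobian f (liftJet θ) with hJ
  set L := Submodule.span (PowerSeries k) (Set.range fun i => J i) with hL
  have hquot : ∀ E : Fin N → ℕ, Nonempty (((Fin N → PowerSeries k) ⧸
      orderSub (k := k) fun j => (E j : ℕ∞)) ≃ₗ[PowerSeries k]
        ((j : Fin N) → CyclicModule k (E j))) := fun E =>
    ⟨(Submodule.quotEquivOfEq _ _ (ker_reduceVec E).symm).trans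
      ((reduceVec E).quotKerEquivOfSurjective (reduceVec_surjective E))⟩
  constructor
  · rintro ⟨E, ⟨hmono, hle, ⟨ρ⟩⟩, hEe, -⟩
    obtain ⟨χ⟩ := hquot E
    have hcod : ∀ q ≤ n + 1, codim q L = ∑ j, min (E j) q := by
      intro q hq
      rw [← codim_sup_orderSub hq L,
        codim_eq_of_equiv ⟨(ψ.trans ρ).trans χ.symm⟩ q, codim_orderSub]
      simp only [toNat_min_natCast]
    obtain ⟨c, hc, hcard⟩ := exists_isAdapted_span fun i => J i
    have hle' : ∀ a : ℕ∞, (min a (n + 1 : ℕ)).toNat ≤ n + 1 := by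
      intro a
      induction a using ENat.recTopCoe with
      | top => rw [min_eq_right le_top, ENat.toNat_natCast]
      | coe a => rw [toNat_min_natCast]; omega
    obtain ⟨τ, hτ⟩ := exists_perm_of_sum_min_eq (fun j => (min (c j) (n + 1 : ℕ)).toNat) E (n + 1)
      (fun j => hle' _) hle (by
        intro q hq
        rw [← hcod q hq, codim_eq_of_equiv hc.nonempty_equiv, codim_orderSub]
        refine Finset.sum_congr rfl fun j _ => ?_
        generalize c j = a
        induction a using ENat.recTopCoe with
        | top =>
          rw [min_eq_right le_top, min_eq_right le_top, ENat.toNat_natCast, ENat.toNat_natCast]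
          omega
        | coe a => rw [toNat_min_natCast, toNat_min_natCast]; omega)
    have hfull : N - m ≤ (Finset.univ.filter fun j => E j = n + 1).card := by
      have h1 : (Finset.univ.filter fun j => c (τ j) = ⊤).card =
          (Finset.univ.filter fun j => c j = ⊤).card := by
        rw [Finset.card_filter, Finset.card_filter]
        exact Equiv.sum_comp τ fun j => if c j = ⊤ then 1 else 0
      have h2 := Finset.card_le_card (show (Finset.univ.filter fun j => c (τ j) = ⊤) ⊆
          Finset.univ.filter fun j => E j = n + 1 by
        intro j hj
        have hj' : c (τ j) = ⊤ := by simpa using hj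
        have := hτ j
        rw [hj', min_eq_right le_top, ENat.toNat_natCast] at this
        simpa using this.symm)
      omega
    -- `E` is increasing with values at most `n + 1`, so the value `n + 1` is taken at the end.
    have htail : ∀ j : Fin N, m ≤ (j : ℕ) → E j = n + 1 := by
      intro j hj
      by_contra hne
      have hsub : (Finset.univ.filter fun j => E j = n + 1) ⊆ Finset.Ioi j := by
        intro r hr
        have hr' : E r = n + 1 := by simpa using hr
        rw [Finset.mem_Ioi]
        by_contra hrj
        have h1 := hmono (not_lt.mp hrj)
        have h2 := hle j
        omega
      have h1 := Finset.card_le_card hsub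
      rw [Fin.card_Ioi] at h1
      have := j.2
      omega
    refine (hasType_iff_codim hmN e (K := n + 1) (fun i => Nat.lt_succ_of_le (hn i)) J).mpr
      fun q hq => ?_
    rw [← hL, hcod q hq, codim_orderSub]
    refine Finset.sum_congr rfl fun j _ => ?_
    rcases lt_or_ge (j : ℕ) m with hj | hj
    · rw [typeOrders_of_lt e hj, toNat_min_natCast, hEe ⟨j, hj⟩ j rfl]
    · rw [typeOrders_of_le e hj, min_eq_right le_top, ENat.toNat_natCast, htail j hj]
      omega
  · intro h
    let E : Fin N → ℕ := fun j => if h : (j : ℕ) < m then e ⟨j, h⟩ else n + 1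
    have hE : (fun j => min (typeOrders N e j) ((n + 1 : ℕ) : ℕ∞)) = fun j => (E j : ℕ∞) := by
      ext1 j
      rcases lt_or_ge (j : ℕ) m with hj | hj
      · rw [typeOrders_of_lt e hj, min_eq_left]
        · simp [E, hj]
        · exact_mod_cast (hn ⟨j, hj⟩).trans (Nat.le_succ n)
      · rw [typeOrders_of_le e hj, min_eq_right le_top]
        simp [E, not_lt.mpr hj]
    obtain ⟨χ⟩ := hquot E
    have h1 := IsAdapted.sup_orderSub h (n + 1)
    rw [hE] at h1
    obtain ⟨ρ⟩ := h1.nonempty_equiv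
    refine ⟨E, ⟨fun a b hab => ?_, fun j => ?_, ⟨(ψ.symm.trans ρ).trans χ⟩⟩, ?_, ?_⟩
    · simp only [E]
      split_ifs with ha hb hb
      · exact he hab
      · exact (hn _).trans (Nat.le_succ n)
      · exact absurd (lt_of_le_of_lt (Fin.le_def.mp hab) hb) ha
      · exact le_rfl
    · simp only [E]
      split_ifs
      · exact (hn _).trans (Nat.le_succ n)
      · exact le_rfl
    · intro i j hij
      have hj : (j : ℕ) < m := hij ▸ i.2
      simp only [E, dif_pos hj]
      congr 1
      exact Fin.ext hij
    · intro j hj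
      simp only [E, dif_neg (not_lt.mpr hj.ge)]
      omega

/-- For an `(l+i)`-jet on `X` of type `e`, the values of `f` at its lift are divisible by
`t^(l+i+1)`, hence lie in `t^(l+1)` times the image of the Jacobian matrix, as `i ≥ e_m`. -/
theorem image_jetsOfType_eq {N m l i : ℕ} (hmN : m ≤ N) (f : Fin m → MvPolynomial (Fin N) k)
    {e : Fin m → ℕ} (he : Monotone e) (hl : lastExp e ≤ l) (hi : lastExp e ≤ i) :
    truncJet (Nat.le_add_right l i) '' jetsOfType (l + i) (Ideal.span (Set.range f)) f e =
      truncatedArcs l (Ideal.span (Set.range f)) f e := by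
  have hle : ∀ r, e r ≤ l := fun r => (le_lastExp e r).trans hl
  have hmem : ∀ θ : Jet k N (l + i), θ ∈ jetsOfType (l + i) (Ideal.span (Set.range f)) f e ↔
      (∀ r, t ^ (l + i + 1) ∣ evalArc f (liftJet θ) r) ∧ HasType e (jacobian f (liftJet θ)) :=
    fun θ => by
      rw [jetsOfType, Set.mem_inter_iff, mem_jets_iff, mem_ambientJetsOfType_iff hmN f he
        fun r => (hle r).trans (Nat.le_add_right l i)]
  ext η
  constructor
  · rintro ⟨θ, hθ, rfl⟩
    obtain ⟨h1, h2⟩ := (hmem θ).mp hθ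
    rw [mem_truncatedArcs_iff_exists hmN f hl _ (γ₀ := liftJet θ) fun j =>
      (dvd_sub_comm).mp (dvd_liftJet_truncJet_sub _ θ j)]
    refine ⟨h2, ?_⟩
    obtain ⟨W, hW⟩ := h2.exists_mul_eq hmN fun r => (le_lastExp e r).trans hi
    choose z hz using h1
    refine ⟨W.mulVec z, ?_⟩
    rw [Matrix.mulVec_mulVec, hW, Matrix.smul_mulVec, Matrix.one_mulVec, smul_smul, ← pow_add]
    ext1 r
    rw [hz, Pi.smul_apply, smul_eq_mul]
    congr 2
    omega
  · rintro ⟨γ, hγ, rfl⟩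
    rw [mem_arcsOfType_iff hmN] at hγ
    refine ⟨truncArc (l + i) γ, (hmem _).mpr ?_, truncJet_truncArc _ γ⟩
    have hd : ∀ j, t ^ (l + i + 1) ∣ liftJet (truncArc (l + i) γ) j - γ j := fun j =>
      (dvd_sub_comm).mp ((truncArc_eq_iff γ _).mp rfl j)
    refine ⟨fun r => ?_, hγ.2.congr hmN (fun r => ?_) (dvd_jacobian_sub f hd)⟩
    · simpa [hγ.1] using dvd_evalArc_sub f hd r
    · have := hle r
      omega

/-! ### Charts over which the truncation maps are trivial -/

/-- The coefficient of `t^(e_1 + ⋯ + e_m)` in the maximal minor of the Jacobian matrix with the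
columns `α`. -/
def minorCoeff {N m : ℕ} (f : Fin m → MvPolynomial (Fin N) k) (e : Fin m → ℕ)
    (α : Fin m → Fin N) (γ : Arc k N) : k :=
  PowerSeries.coeff (∑ i, e i) ((jacobian f γ).submatrix id α).det

/-- The open subset of `π_l(𝓛^{e_1,…,e_m}(X))` on which the maximal minor of the Jacobian matrix
with the columns `α` has the minimal order `e_1 + ⋯ + e_m`. -/
def chart {N m : ℕ} (l : ℕ) (f : Fin m → MvPolynomial (Fin N) k) (e : Fin m → ℕ)
    (α : Fin m → Fin N) : Set (Jet k N l) :=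
  {x ∈ truncatedArcs l (Ideal.span (Set.range f)) f e | minorCoeff f e α (liftJet x) ≠ 0}

theorem truncJet_mem_truncatedArcs {N m n l : ℕ} (h : l ≤ n) {I : Ideal (MvPolynomial (Fin N) k)}
    {f : Fin m → MvPolynomial (Fin N) k} {e : Fin m → ℕ} {x : Jet k N n}
    (hx : x ∈ truncatedArcs n I f e) : truncJet h x ∈ truncatedArcs l I f e := by
  obtain ⟨γ, hγ, rfl⟩ := hx
  exact ⟨γ, hγ, rfl⟩

/-- The charts at all levels `n ≥ e_m` are the preimages of those at level `e_m`. -/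
theorem setOf_truncJet_mem_chart {N m n l : ℕ} (hmN : m ≤ N) (f : Fin m → MvPolynomial (Fin N) k)
    {e : Fin m → ℕ} (hl : lastExp e ≤ l) (h : l ≤ n) (α : Fin m → Fin N) :
    {x ∈ truncatedArcs n (Ideal.span (Set.range f)) f e | truncJet h x ∈ chart l f e α} =
      chart n f e α := by
  ext x
  refine and_congr_right fun hx => ?_
  have hx' := truncJet_mem_truncatedArcs h hx
  have h1 := ((mem_truncatedArcs_iff hmN f (hl.trans h) x).mp hx).1
  have h2 := ((mem_truncatedArcs_iff hmN f hl _).mp hx').1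
  have h3 := h1.coeff_det_eq hmN (fun i => (le_lastExp e i).trans hl) h2
    (dvd_jacobian_sub f (dvd_liftJet_truncJet_sub h x)) α
  rw [chart]
  change _ ∧ minorCoeff f e α (liftJet (truncJet h x)) ≠ 0 ↔ _
  rw [minorCoeff, minorCoeff, h3]
  exact and_iff_right hx'

theorem isMorphism_truncJet {N n l : ℕ} (h : l ≤ n) {T : Set (Jet k N n)} {S : Set (Jet k N l)}
    (hTS : Set.MapsTo (truncJet h) T S) : IsMorphism T S (truncJet h) :=
  isMorphism_of_eval hTS fun s => ⟨X (s.1, Fin.castLE (Nat.succ_le_succ h) s.2), fun x => by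
    simp [truncJet]⟩

/-- The jet `η + t^(l+1) v`. -/
def snocJet {N l : ℕ} (η : Jet k N l) (v : Fin N → k) : Jet k N (l + 1) := fun s =>
  Fin.snoc (α := fun _ => k) (fun i => η (s.1, i)) (v s.1) s.2

theorem snocJet_castSucc {N l : ℕ} (η : Jet k N l) (v : Fin N → k) (j : Fin N) (i : Fin (l + 1)) :
    snocJet η v (j, i.castSucc) = η (j, i) := by
  simp [snocJet]

theorem snocJet_last {N l : ℕ} (η : Jet k N l) (v : Fin N → k) (j : Fin N) :
    snocJet η v (j, Fin.last (l + 1)) = v j := by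
  simp [snocJet]

theorem snocJet_truncJet {N l : ℕ} (x : Jet k N (l + 1)) :
    snocJet (truncJet (Nat.le_succ l) x) (fun j => x (j, Fin.last (l + 1))) = x := by
  ext ⟨j, i⟩
  induction i using Fin.lastCases with
  | last => rw [snocJet_last]
  | cast i => rw [snocJet_castSucc]; rfl

theorem truncJet_snocJet {N l : ℕ} (η : Jet k N l) (v : Fin N → k) :
    truncJet (Nat.le_succ l) (snocJet η v) = η := by
  ext ⟨j, i⟩
  exact snocJet_castSucc η v j i

theorem liftJet_snocJet {N l : ℕ} (η : Jet k N l) (v : Fin N → k) :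
    liftJet (snocJet η v) = liftJet η + t ^ (l + 1) • fun j => PowerSeries.C (v j) := by
  ext1 j
  rw [liftJet, Fin.sum_univ_castSucc]
  simp only [snocJet_castSucc, snocJet_last, Fin.val_castSucc, Fin.val_last, Pi.add_apply,
    Pi.smul_apply, smul_eq_mul, liftJet]
  rw [mul_comm (t ^ (l + 1))]

/-- The coefficient of `t^(l+1+e_1+⋯+e_m)` in the `i`-th entry of
`adj(J_α) (f(η) + t^(l+1) J v)`, where `J` is the Jacobian matrix at `η` and `J_α` consists of its
columns `α`. -/
def obstruction {N m l : ℕ} (f : Fin m → MvPolynomial (Fin N) k) (e : Fin m → ℕ)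
    (α : Fin m → Fin N) (η : Jet k N l) (v : Fin N → k) (i : Fin m) : k :=
  PowerSeries.coeff (l + 1 + ∑ i, e i)
    (((jacobian f (liftJet η)).submatrix id α).adjugate.mulVec (evalArc f (liftJet η) +
      t ^ (l + 1) • (jacobian f (liftJet η)).mulVec fun j => PowerSeries.C (v j)) i)

/-- Over a chart, `η + t^(l+1) v` lifts to an arc of type `e` exactly if the obstruction, which is
affine linear in `v`, vanishes. -/
theorem snocJet_mem_iff {N m l : ℕ} (hmN : m ≤ N) (f : Fin m → MvPolynomial (Fin N) k)
    {e : Fin m → ℕ} (hl : lastExp e ≤ l) {α : Fin m → Fin N} {η : Jet k N l}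
    (hη : η ∈ chart l f e α) (v : Fin N → k) :
    snocJet η v ∈ truncatedArcs (l + 1) (Ideal.span (Set.range f)) f e ↔
      ∀ i, obstruction f e α η v i = 0 := by
  obtain ⟨hη, hα⟩ := hη
  obtain ⟨hT, w₀, hw₀⟩ := (mem_truncatedArcs_iff hmN f hl η).mp hη
  have hle : ∀ i, e i ≤ l := fun i => (le_lastExp e i).trans hl
  set J := jacobian f (liftJet η) with hJ
  set V : Fin N → PowerSeries k := fun j => PowerSeries.C (v j) with hV
  set s := ∑ i, e i with hs
  have hdet := hT.dvd_det_submatrix hmN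
  set γ₁ := liftJet (snocJet η v) with hγ₁
  have hγ₁' : γ₁ = liftJet η + t ^ (l + 1) • V := liftJet_snocJet η v
  have hd : ∀ j, t ^ (l + 1) ∣ γ₁ j - liftJet η j := fun j => by simp [hγ₁']
  have hJd := dvd_jacobian_sub f hd
  have hT₁ : HasType e (jacobian f γ₁) := hT.congr hmN (fun i => Nat.lt_succ_of_le (hle i)) hJd
  obtain ⟨W, hW⟩ := hT.exists_mul_eq hmN hle
  have hR : ∀ i, ∃ r, evalArc f γ₁ i - evalArc f (liftJet η) i - t ^ (l + 1) * J.mulVec V i =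
      t ^ (l + 2) * (t ^ l * r) := by
    intro i
    obtain ⟨r, hr⟩ := dvd_evalArc_sub_deriv f (liftJet η) (δ := t ^ (l + 1) • V) (a := l + 1)
      (fun j => by simp) i
    refine ⟨r, ?_⟩
    rw [Matrix.mulVec_smul, ← hγ₁'] at hr
    rw [← mul_assoc, ← pow_add, show l + 2 + l = 2 * (l + 1) by ring]
    exact hr
  choose r hr using hR
  have hsplit : evalArc f γ₁ = (evalArc f (liftJet η) + t ^ (l + 1) • J.mulVec V) +
      t ^ (l + 2) • J.mulVec (W.mulVec r) := by
    rw [Matrix.mulVec_mulVec, hW, Matrix.smul_mulVec, Matrix.one_mulVec]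
    ext1 i
    simp only [Pi.add_apply, Pi.smul_apply, smul_eq_mul]
    linear_combination hr i
  rw [mem_truncatedArcs_iff hmN f (hl.trans (Nat.le_succ l))]
  have h1 : (∃ w, evalArc f γ₁ = t ^ (l + 1 + 1) • (jacobian f γ₁).mulVec w) ↔
      ∃ w, evalArc f γ₁ = t ^ (l + 2) • J.mulVec w := by
    constructor
    · rintro ⟨w, hw⟩
      obtain ⟨w', hw'⟩ := hT.exists_mulVec_eq hmN hle hJd w
      exact ⟨w', by rw [hw, hw']⟩
    · rintro ⟨w, hw⟩
      obtain ⟨w', hw'⟩ := hT₁.exists_mulVec_eq hmN hle (fun i j => (dvd_sub_comm).mp (hJd i j)) w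
      exact ⟨w', by rw [hw, hw']⟩
  rw [and_iff_right hT₁, h1, exists_eq_smul_mulVec_iff hdet hα]
  refine forall_congr' fun i => ?_
  have h2 := dvd_adjugate_mulVec (a := l + 2) hdet α ⟨_, rfl⟩ (z := t ^ (l + 2) •
    J.mulVec (W.mulVec r)) i
  have h3 := dvd_adjugate_mulVec (a := l + 1) hdet α ⟨w₀ + V, by rw [Matrix.mulVec_add, smul_add]⟩
    (z := t ^ (l + 1) • J.mulVec w₀ + t ^ (l + 1) • J.mulVec V) i
  rw [← hw₀] at h3
  rw [hsplit, Matrix.mulVec_add, Pi.add_apply, dvd_add_left h2]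
  rw [PowerSeries.X_pow_dvd_iff] at h3 ⊢
  constructor
  · intro h
    exact h _ (by omega)
  · intro h c hc
    rcases Nat.lt_or_ge c (l + 1 + s) with hc' | hc'
    · exact h3 c hc'
    · obtain rfl : c = l + 1 + s := by omega
      exact h

/-- The obstruction depends on the coordinates `v_α` only through the multiple `minorCoeff • v_α` of
them. -/
theorem obstruction_eq {N m l : ℕ} (f : Fin m → MvPolynomial (Fin N) k) (e : Fin m → ℕ)
    {α : Fin m → Fin N} (hα : Function.Injective α) (η : Jet k N l) (v v' : Fin N → k)
    (h : ∀ j, j ∉ Set.range α → v j = v' j) (h' : ∀ i, v' (α i) = 0) (i : Fin m) :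
    obstruction f e α η v i = obstruction f e α η v' i + minorCoeff f e α (liftJet η) * v (α i) := by
  set J := jacobian f (liftJet η) with hJ
  set s := ∑ i, e i with hs
  have h1 : J.mulVec (fun j => PowerSeries.C (v j)) = J.mulVec (fun j => PowerSeries.C (v' j)) +
      (J.submatrix id α).mulVec fun i => PowerSeries.C (v (α i)) := by
    rw [submatrix_eq_mul, ← Matrix.mulVec_mulVec, ← Matrix.mulVec_add]
    congr 1
    ext1 j
    have h2 : ((1 : Matrix (Fin N) (Fin N) (PowerSeries k)).submatrix id α).mulVec
        (fun i => PowerSeries.C (v (α i))) j =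
        ∑ i, if j = α i then PowerSeries.C (v (α i)) else 0 := by
      simp [Matrix.mulVec, dotProduct, Matrix.one_apply]
    rw [Pi.add_apply, h2]
    by_cases hj : j ∈ Set.range α
    · obtain ⟨i, rfl⟩ := hj
      rw [h' i, Finset.sum_eq_single i]
      · simp
      · intro r _ hr
        rw [if_neg fun h => hr (hα h).symm]
      · simp
    · rw [h j hj, Finset.sum_eq_zero, add_zero]
      intro i _
      rw [if_neg fun h => hj ⟨i, h.symm⟩]
  rw [obstruction, obstruction, minorCoeff, ← hJ, ← hs, h1, smul_add, ← add_assoc, Matrix.mulVec_add,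
    Matrix.mulVec_smul, Matrix.mulVec_mulVec, Matrix.adjugate_mul, Matrix.smul_mulVec,
    Matrix.one_mulVec, Pi.add_apply, map_add]
  congr 1
  simp only [Pi.smul_apply, smul_eq_mul]
  rw [add_comm (l + 1) s, PowerSeries.coeff_X_pow_mul, PowerSeries.coeff_mul_C]

/-- An enumeration of the `N` columns which starts with the columns `α`. -/
theorem exists_sumEquiv {N m : ℕ} {α : Fin m → Fin N} (hα : Function.Injective α) :
    ∃ κ : Fin m ⊕ Fin (N - m) ≃ Fin N, ∀ i, κ (Sum.inl i) = α i := by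
  classical
  have hcard : Fintype.card (Fin (N - m)) = Fintype.card ((Set.range α)ᶜ : Set (Fin N)) := by
    rw [Fintype.card_compl_set, Fintype.card_fin, Fintype.card_fin, Set.card_range_of_injective hα,
      Fintype.card_fin]
  refine ⟨(Equiv.sumCongr (Equiv.ofInjective α hα) (Fintype.equivOfCardEq hcard)).trans
    (Equiv.Set.sumCompl (Set.range α)), fun i => ?_⟩
  simp

theorem isPolyFamily_liftJet_inl {N l d : ℕ} (j : Fin N) :
    IsPolyFamily fun z : (Fin N × Fin (l + 1)) ⊕ Fin d → k =>
      liftJet (n := l) (fun s => z (Sum.inl s)) j :=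
  isPolyFamily_liftJet (fun s => ⟨X (Sum.inl s), fun x => by simp⟩) j

/-- On a chart, solving the vanishing of the obstruction for the coordinates `v_α` makes the
truncation of `(l+1)`-jets to `l`-jets the projection of a graph. -/
theorem isTrivialFibration_chart {N m l : ℕ} (hmN : m ≤ N) (f : Fin m → MvPolynomial (Fin N) k)
    {e : Fin m → ℕ} (hl : lastExp e ≤ l) {α : Fin m → Fin N} (hα : Function.Injective α) :
    IsTrivialFibration (chart (l + 1) f e α) (chart l f e α) (truncJet (Nat.le_succ l))
      (N - m) := by
  obtain ⟨κ, hκ⟩ := exists_sumEquiv hα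
  have hβ : ∀ j, j ∉ Set.range α → ∃ b, j = κ (Sum.inr b) := by
    intro j hj
    obtain ⟨(a | b), rfl⟩ := κ.surjective j
    · exact absurd ⟨a, (hκ a).symm⟩ hj
    · exact ⟨b, rfl⟩
  have hchart := setOf_truncJet_mem_chart hmN f hl (Nat.le_succ l) α
  have hmem : ∀ (η : Jet k N l) v, snocJet η v ∈ chart (l + 1) f e α ↔
      η ∈ chart l f e α ∧ ∀ i, obstruction f e α η v i = 0 := by
    intro η v
    rw [← hchart]
    change _ ∧ truncJet _ (snocJet η v) ∈ _ ↔ _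
    rw [truncJet_snocJet, and_comm]
    exact and_congr_right fun hη => snocJet_mem_iff hmN f hl hη v
  -- `ext₀ y` has the coordinates `y` outside `α`, and `0` in `α`.
  let ext₀ : (Fin (N - m) → k) → Fin N → k := fun y j => Sum.elim (fun _ => 0) y (κ.symm j)
  have hext : ∀ y i, ext₀ y (α i) = 0 := fun y i => by simp [ext₀, ← hκ]
  let base : ((Fin N × Fin (l + 1)) ⊕ Fin (N - m) → k) → Jet k N l := fun z s => z (Sum.inl s)
  let fib : ((Fin N × Fin (l + 1)) ⊕ Fin (N - m) → k) → Fin (N - m) → k := fun z b => z (Sum.inr b)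
  let sol : ((Fin N × Fin (l + 1)) ⊕ Fin (N - m) → k) → Fin N → k := fun z j =>
    Sum.elim (fun i => -obstruction f e α (base z) (ext₀ (fib z)) i /
      minorCoeff f e α (liftJet (base z))) (fib z) (κ.symm j)
  have hsolα : ∀ z i, sol z (α i) = -obstruction f e α (base z) (ext₀ (fib z)) i /
      minorCoeff f e α (liftJet (base z)) := fun z i => by simp [sol, ← hκ]
  have hsolβ : ∀ z b, sol z (κ (Sum.inr b)) = fib z b := fun z b => by simp [sol]
  have hobs : ∀ (η : Jet k N l) (v : Fin N → k) i, obstruction f e α η v i =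
      obstruction f e α η (ext₀ fun b => v (κ (Sum.inr b))) i +
        minorCoeff f e α (liftJet η) * v (α i) := fun η v i =>
    obstruction_eq f e hα η v _ (fun j hj => by
      obtain ⟨b, rfl⟩ := hβ j hj
      simp [ext₀]) (hext _) i
  have hpolyJ : ∀ i j, IsPolyFamily fun z => jacobian f (liftJet (base z)) i j :=
    isPolyFamily_jacobian f isPolyFamily_liftJet_inl
  have hpolyext : ∀ j, IsPolyFamily fun z => PowerSeries.C (ext₀ (fib z) j) := by
    intro j
    rcases hj : κ.symm j with a | b
    · simp only [ext₀, hj, Sum.elim_inl]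
      exact IsPolyFamily.const _
    · simp only [ext₀, hj, Sum.elim_inr]
      simpa using IsPolyFamily.C_eval (X (Sum.inr b) : MvPolynomial _ k)
  have hpolyobs : ∀ i, ∃ p : MvPolynomial ((Fin N × Fin (l + 1)) ⊕ Fin (N - m)) k, ∀ z,
      obstruction f e α (base z) (ext₀ (fib z)) i = eval z p := fun i =>
    (IsPolyFamily.adjugate_mulVec (fun i j => hpolyJ i (α j))
      (fun i => (isPolyFamily_evalArc f isPolyFamily_liftJet_inl i).add
        ((IsPolyFamily.const _).mul (IsPolyFamily.mulVec hpolyJ hpolyext i))) i).exists_eval_eq_coeff _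
  have hpolyminor : ∃ q : MvPolynomial ((Fin N × Fin (l + 1)) ⊕ Fin (N - m)) k, ∀ z,
      minorCoeff f e α (liftJet (base z)) = eval z q :=
    (IsPolyFamily.det fun i j => hpolyJ i (α j)).exists_eval_eq_coeff _
  choose p hp using hpolyobs
  obtain ⟨q, hq⟩ := hpolyminor
  have htrunc : Set.MapsTo (truncJet (Nat.le_succ l)) (chart (l + 1) f e α) (chart l f e α) := by
    intro x hx
    rw [← hchart] at hx
    exact hx.2
  refine ⟨isMorphism_truncJet _ htrunc,
    fun x => Sum.elim (truncJet (Nat.le_succ l) x) fun b => x (κ (Sum.inr b), Fin.last (l + 1)),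
    fun z => snocJet (base z) (sol z), ?_, ⟨?_, ?_⟩, ?_, ?_, fun x _ => rfl⟩
  · refine isMorphism_of_eval (fun x hx => htrunc hx) ?_
    rintro (s | b)
    · exact ⟨X (s.1, Fin.castLE (Nat.succ_le_succ (Nat.le_succ l)) s.2), fun x => by simp [truncJet]⟩
    · exact ⟨X (κ (Sum.inr b), Fin.last (l + 1)), fun x => by simp⟩
  · intro z hz
    refine (hmem _ _).mpr ⟨hz, fun i => ?_⟩
    have hne : minorCoeff f e α (liftJet (base z)) ≠ 0 := hz.2
    rw [hobs, hsolα]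
    simp only [hsolβ]
    field_simp
    ring
  · rintro ⟨j, i⟩ z hz
    induction i using Fin.lastCases with
    | cast i =>
      simp only [snocJet_castSucc]
      exact ⟨X (Sum.inl (j, i)), 1, by simp, fun y _ _ => by simp [base]⟩
    | last =>
      simp only [snocJet_last]
      obtain ⟨(a | b), rfl⟩ := κ.surjective j
      · simp only [hκ, hsolα]
        refine ⟨-p a, q, ?_, fun y _ _ => ?_⟩
        · rw [← hq]
          exact hz.2
        · rw [hp, hq, map_neg]
      · simp only [hsolβ]
        exact ⟨X (Sum.inr b), 1, by simp, fun y _ _ => by simp [fib]⟩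
  · intro x hx
    have hx' := hx
    rw [← snocJet_truncJet x, hmem] at hx'
    conv_rhs => rw [← snocJet_truncJet x]
    change snocJet (truncJet (Nat.le_succ l) x) _ = _
    congr 1
    ext1 j
    obtain ⟨(a | b), rfl⟩ := κ.surjective j
    · have h1 := hx'.2 a
      have hne : minorCoeff f e α (liftJet (truncJet (Nat.le_succ l) x)) ≠ 0 := hx'.1.2
      rw [hobs] at h1
      rw [hκ, hsolα]
      change -obstruction f e α (truncJet (Nat.le_succ l) x)
        (ext₀ fun b => x (κ (Sum.inr b), Fin.last (l + 1))) a /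
        minorCoeff f e α (liftJet (truncJet (Nat.le_succ l) x)) = _
      rw [div_eq_iff hne]
      linear_combination -h1
    · rw [hsolβ]
      rfl
  · intro z hz
    ext (s | b)
    · change truncJet (Nat.le_succ l) (snocJet (base z) (sol z)) s = _
      rw [truncJet_snocJet]
    · change snocJet (base z) (sol z) (_, _) = _
      rw [snocJet_last, hsolβ]

theorem isTrivialFibration_chart_of_lt {N m l : ℕ} (hmN : m ≤ N)
    (f : Fin m → MvPolynomial (Fin N) k) {e : Fin m → ℕ} (hl : lastExp e ≤ l)
    {α : Fin m → Fin N} (hα : Function.Injective α) (n : ℕ) (hln : l < n) :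
    IsTrivialFibration (chart n f e α) (chart l f e α) (truncJet hln.le) ((N - m) * (n - l)) := by
  induction n, hln using Nat.le_induction with
  | base => simpa using isTrivialFibration_chart hmN f hl hα
  | succ n hn ih =>
    refine (isTrivialFibration_chart hmN f (hl.trans (Nat.le_of_succ_le hn)) hα).comp ?_ ih
    rw [show n + 1 - l = (n - l) + 1 by omega]
    ring

/-- The charts cover `π_l(𝓛^{e_1,…,e_m}(X))`. -/
theorem exists_mem_chart {N m l : ℕ} (hmN : m ≤ N) (f : Fin m → MvPolynomial (Fin N) k)
    {e : Fin m → ℕ} (hl : lastExp e ≤ l) {x : Jet k N l}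
    (hx : x ∈ truncatedArcs l (Ideal.span (Set.range f)) f e) :
    ∃ α : Fin m → Fin N, Function.Injective α ∧ x ∈ chart l f e α := by
  obtain ⟨α, hα⟩ :=
    ((mem_truncatedArcs_iff hmN f hl x).mp hx).1.exists_coeff_det_ne_zero hmN
  refine ⟨α, fun a b hab => ?_, hx, hα⟩
  by_contra hne
  exact hα (by rw [Matrix.det_zero_of_column_eq hne fun r => by simp [hab], map_zero])

theorem isOpenSubsetOf_chart {N m : ℕ} (l : ℕ) (f : Fin m → MvPolynomial (Fin N) k)
    (e : Fin m → ℕ) (α : Fin m → Fin N) :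
    IsOpenSubsetOf (chart l f e α) (truncatedArcs l (Ideal.span (Set.range f)) f e) := by
  have hlift : ∀ j, IsPolyFamily fun η : Jet k N l => liftJet η j :=
    isPolyFamily_liftJet fun s => ⟨X s, fun x => by simp⟩
  obtain ⟨q, hq⟩ := (IsPolyFamily.det fun i j =>
    isPolyFamily_jacobian f hlift i (α j)).exists_eval_eq_coeff (∑ i, e i)
  refine ⟨{x | eval x q ≠ 0}, isOpen_eval_ne_zero q, ?_⟩
  ext x
  refine and_congr_right fun _ => ?_
  change _ ↔ eval x q ≠ 0
  rw [← hq]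
  rfl

end JetArc
end

theorem proposition1 {k : Type*} [Field k] [IsAlgClosed k] {N m : ℕ} (hmN : m ≤ N)
    (I : Ideal (MvPolynomial (Fin N) k)) (f : Fin m → MvPolynomial (Fin N) k)
    (hI : I = Ideal.span (Set.range f))
    (e : Fin m → ℕ) (he : Monotone e) :
    -- (a)
    (∀ l i : ℕ, JetArc.lastExp e ≤ l → JetArc.lastExp e ≤ i →
      JetArc.truncJet (Nat.le_add_right l i) '' JetArc.jetsOfType (l + i) I f e
          = JetArc.truncatedArcs l I f e ∧
        JetArc.IsLocClosed (JetArc.truncatedArcs l I f e)) ∧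
    -- (b)
    (∀ γ ∈ JetArc.truncatedArcs (JetArc.lastExp e) I f e,
      ∃ U : Set (JetArc.Jet k N (JetArc.lastExp e)),
        JetArc.IsOpenSubsetOf U (JetArc.truncatedArcs (JetArc.lastExp e) I f e) ∧ γ ∈ U ∧
        ∀ (l : ℕ) (hl : JetArc.lastExp e ≤ l),
          JetArc.IsTrivialFibration
            {x ∈ JetArc.truncatedArcs (l + 1) I f e |
              JetArc.truncJet (hl.trans (Nat.le_succ l)) x ∈ U}
            {x ∈ JetArc.truncatedArcs l I f e | JetArc.truncJet hl x ∈ U}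
            (JetArc.truncJet (Nat.le_succ l)) (N - m)) ∧
    -- (c)
    (∀ (n l : ℕ) (hln : l < n), JetArc.lastExp e ≤ l →
      JetArc.IsLocallyTrivialFibration
        (JetArc.truncatedArcs n I f e) (JetArc.truncatedArcs l I f e)
        (JetArc.truncJet hln.le) ((N - m) * (n - l))) := by
  subst hI
  refine ⟨fun l i hl hi => ⟨JetArc.image_jetsOfType_eq hmN f he hl hi,
    JetArc.isLocClosed_truncatedArcs hmN f hl⟩, fun γ hγ => ?_, fun n l hln hl => ?_⟩
  · obtain ⟨α, hα, hγα⟩ := JetArc.exists_mem_chart hmN f le_rfl hγ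
    refine ⟨_, JetArc.isOpenSubsetOf_chart _ f e α, hγα, fun l hl => ?_⟩
    rw [JetArc.setOf_truncJet_mem_chart hmN f le_rfl, JetArc.setOf_truncJet_mem_chart hmN f le_rfl]
    exact JetArc.isTrivialFibration_chart hmN f hl hα
  · refine ⟨JetArc.isMorphism_truncJet _ fun x hx =>
      JetArc.truncJet_mem_truncatedArcs hln.le hx, fun x hx => ?_⟩
    obtain ⟨α, hα, hxα⟩ := JetArc.exists_mem_chart hmN f hl hx
    refine ⟨_, JetArc.isOpenSubsetOf_chart _ f e α, hxα, ?_⟩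
    rw [JetArc.setOf_truncJet_mem_chart hmN f hl]
    exact JetArc.isTrivialFibration_chart_of_lt hmN f hl hα n hln
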